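/- **Setting.** Let $S$ and $A$ be finite non-empty sets, $r:S\times A\to[0,1]$ a reward function, $P=\{p_{s,a}\}$ a transition kernel ($p_{s,a}$ is a probability vector on $S$ for each $(s,a)$) and $\gamma\in[1/2,1)$. Let $\Pi$ be the set of all maps $\pi:S\to A$, and let $P_\pi(s,s')=p_{s,\pi(s)}(s')$. Assume uniform ergodicity: for every $\pi\in\Pi$ there are $m\ge1$, $q\in(0,1]$ and a probability vector $\psi$ on $S$ with $P_\pi^m(s,\cdot)\ge q\,\psi(\cdot)$ for all $s\in S$. Let $t_{\mathrm{minorize}}=\max_{\pi\in\Pi}\inf\{m/q\}$, where the infimum is over all pairs $m\ge 1$, $q\in(0,1]$ for which such a $\psi$ exists. Let $\delta\in(0,1)$, $\zeta\in(0,1]$, $\eta\in(0,1]$ and $n\in\mathbb N$. Let $Z(s,a)$, $(s,a)\in S\times A$, be i.i.d. uniform on $[0,\zeta]$, and put $R=r+Z$. Independently of $Z$, let $S^{(i)}_{s,a}$ ($1\le i\le n$, $(s,a)\in S\times A$) be independent with $S^{(i)}_{s,a}\sim p_{s,a}$, and let $\hat p_{s,a}(s')=\frac1n\sum_{i=1}^n\mathbf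 1\{S^{(i)}_{s,a}=s'\}$ and $\widehat P_\pi(s,s')=\hat p_{s,\pi(s)}(s')$. For $\pi\in\Pi$ and $R_\pi(s)=R(s,\pi(s))$ let $$v_0^\pi=(I-\gamma P_\pi)^{-1}R_\pi,\qquad \hat v_0^\pi=(I-\gamma\widehat P_\pi)^{-1}R_\pi .$$ Let $\pi_0$ maximize $v_0^{\pi}$ over $\pi\in\Pi$ (in every coordinate). Let $\hat v_0$ solve $\hat v_0(s)=\max_{a}\{R(s,a)+\gamma\sum_{s'}\hat p_{s,a}(s')\hat v_0(s')\}$ and let $\hat\pi_0(s)\in\arg\max_a\{R(s,a)+\gamma\sum_{s'}\hat p_{s,a}(s')\hat v_0(s')\}$ be any greedy policy. With $\hat q_0(s,b)=R(s,b)+\gamma\sum_{s'}\hat p_{s,b}(s')\hat v_0^{\hat\pi_0}(s')$ let $$\Omega_\eta=\Big\{\inf_{s\in S}\big(\hat v_0^{\hat\pi_0}(s)-\max_{b\ne\hat\pi_0(s)}\hat q_0(s,b)\big)\ge\eta\Big\},\qquad \beta_\delta(\eta)=2\log\Big(\frac{24|S||A|\log_2((1-\gamma)^{-1})}{(1-\gamma)^2\eta\delta}\Big)$$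 (a maximum over the empty set being $-\infty$). **Proposition.** If $\Omega_\eta$ has probability at least $1-\delta/3$ and $n\ge 64\,\beta_\delta(\eta)(1-\gamma)^{-1}$, then there is an event of probability at least $1-\delta$ on which both $$\big\|\hat v_0^{\hat\pi_0}-v_0^{\hat\pi_0}\big\|_\infty\le 243\sqrt{\frac{\beta_\delta(\eta)\,t_{\mathrm{minorize}}}{(1-\gamma)^2n}}\qquad\text{and}\qquad v_0^{\pi_0}(s)-v_0^{\hat\pi_0}(s)\le 486\sqrt{\frac{\beta_\delta(\eta)\,t_{\mathrm{minorize}}}{(1-\gamma)^2n}}\quad\text{for all }s\in S .$$ -/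

import Mathlib

open MeasureTheory ProbabilityTheory

noncomputable section

namespace PMBP

variable {S A Ω : Type*} [Fintype S] [Fintype A] [DecidableEq S] [MeasurableSpace Ω]

/-- `p (s, a) s'` is the probability of moving to `s'` when action `a` is chosen in state `s`:
each `p (s, a)` is a probability vector on `S`. -/
def IsTransitionKernel (p : S × A → S → ℝ) : Prop :=
  ∀ z, (∀ s', 0 ≤ p z s') ∧ ∑ s', p z s' = 1

/-- The transition matrix `P_π(s, s') = p_{s, π(s)}(s')` of a stationary deterministic policy. -/
def policyMatrix (p : S × A → S → ℝ) (π : S → A) : Matrix S S ℝ :=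
  Matrix.of fun s s' => p (s, π s) s'

/-- The discounted value vector `(I - γ P_π)⁻¹ R_π`, with `R_π(s) = R(s, π(s))`. -/
def value (γ : ℝ) (p : S × A → S → ℝ) (R : S × A → ℝ) (π : S → A) : S → ℝ :=
  Matrix.mulVec (1 - γ • policyMatrix p π)⁻¹ (fun s => R (s, π s))

/-- The one-step lookahead `R(s, a) + γ p_{s, a}[v]`. -/
def lookahead (γ : ℝ) (p : S × A → S → ℝ) (R : S × A → ℝ) (v : S → ℝ) (z : S × A) : ℝ :=
  R z + γ * ∑ s', p z s' * v s'

/-- The state-action value function of a policy, `q^π(s, a) = R(s, a) + γ p_{s, a}[v^π]`. -/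
def actionValue (γ : ℝ) (p : S × A → S → ℝ) (R : S × A → ℝ) (π : S → A) (z : S × A) : ℝ :=
  lookahead γ p R (value γ p R π) z

/-- The policy `π` is optimal for the discounted problem `(R, p, γ)`, among all stationary
deterministic policies and from all initial states simultaneously. -/
def IsOptimalPolicy (γ : ℝ) (p : S × A → S → ℝ) (R : S × A → ℝ) (π : S → A) : Prop :=
  ∀ (π' : S → A) (s : S), value γ p R π' s ≤ value γ p R π s

/-- `v` solves the Bellman equation `v(s) = max_a {R(s, a) + γ p_{s, a}[v]}`. -/
def SolvesBellman [Nonempty A] (γ : ℝ) (p : S × A → S → ℝ) (R : S × A → ℝ) (v : S → ℝ) : Prop :=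
  ∀ s, v s = Finset.univ.sup' Finset.univ_nonempty (fun a : A => lookahead γ p R v (s, a))

/-- `π(s) ∈ argmax_a {R(s, a) + γ p_{s, a}[v]}` for every `s`. -/
def IsGreedy (γ : ℝ) (p : S × A → S → ℝ) (R : S × A → ℝ) (v : S → ℝ) (π : S → A) : Prop :=
  ∀ s a, lookahead γ p R v (s, a) ≤ lookahead γ p R v (s, π s)

/-- `v^π(s) - max_{b ≠ π(s)} q^π(s, b) ≥ η` for every `s` (the maximum over the empty set is
`-∞`, so there is no condition when `A` has one element). -/
def HasGap (γ : ℝ) (p : S × A → S → ℝ) (R : S × A → ℝ) (π : S → A) (η : ℝ) : Prop :=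
  ∀ s, ∀ b, b ≠ π s → η ≤ value γ p R π s - actionValue γ p R π (s, b)

/-- The minorization condition `M^m(s, ·) ≥ q ψ(·)` for all `s`, for some probability vector
`ψ` on `S`. -/
def Minorizes (M : Matrix S S ℝ) (m : ℕ) (q : ℝ) : Prop :=
  1 ≤ m ∧ 0 < q ∧ q ≤ 1 ∧
    ∃ ψ : S → ℝ, (∀ s', 0 ≤ ψ s') ∧ ∑ s', ψ s' = 1 ∧ ∀ s s', q * ψ s' ≤ (M ^ m) s s'

/-- Uniform ergodicity: the transition matrix of every policy satisfies a minorization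
(Doeblin) condition. -/
def UniformlyErgodic (p : S × A → S → ℝ) : Prop :=
  ∀ π : S → A, ∃ (m : ℕ) (q : ℝ), Minorizes (policyMatrix p π) m q

/-- The minorization time of a transition matrix: the infimum of `m / q`. -/
def minorizationTime (M : Matrix S S ℝ) : ℝ :=
  sInf {t : ℝ | ∃ (m : ℕ) (q : ℝ), Minorizes M m q ∧ t = m / q}

/-- The minorization time of the decision process: the maximum over all (finitely many)
policies. -/
def tMinorize (p : S × A → S → ℝ) : ℝ :=
  ⨆ π : S → A, minorizationTime (policyMatrix p π)

/-- `β_δ(η) = 2 log (24 |S| |A| log₂((1 - γ)⁻¹) / ((1 - γ)² η δ))`. -/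
def beta (S A : Type*) [Fintype S] [Fintype A] (γ δ η : ℝ) : ℝ :=
  2 * Real.log (24 * (Fintype.card S : ℝ) * (Fintype.card A : ℝ) * Real.logb 2 ((1 - γ)⁻¹) /
    ((1 - γ) ^ 2 * η * δ))

/-- The empirical kernel `p̂_{s, a}(s') = n⁻¹ ∑_i 1{S_{s, a}^{(i)} = s'}`, at the outcome `ω`. -/
def empiricalKernel {n : ℕ} (X : (S × A) × Fin n → Ω → S) (ω : Ω) : S × A → S → ℝ :=
  fun z s' => (1 / (n : ℝ)) * ∑ i : Fin n, if X (z, i) ω = s' then 1 else 0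

/-- The perturbed reward `R = r + Z`, at the outcome `ω`. -/
def perturbedReward (r : S × A → ℝ) (Z : S × A → Ω → ℝ) (ω : Ω) : S × A → ℝ :=
  fun z => r z + Z z ω

/-- The randomness of perturbed model-based planning: reward perturbations `Z(s, a)`, i.i.d.
uniform on `[0, ζ]`, and, for each state-action pair, `n` draws from `p_{s, a}`; all of these
random variables are mutually independent. -/
structure IsSampling [MeasurableSpace S] (P : Measure Ω) (p : S × A → S → ℝ) (ζ : ℝ) (n : ℕ)
    (Z : S × A → Ω → ℝ) (X : (S × A) × Fin n → Ω → S) : Prop where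
  measurable_Z : ∀ z, Measurable (Z z)
  mem_Z : ∀ z ω, Z z ω ∈ Set.Icc 0 ζ
  uniform_Z : ∀ z, pdf.IsUniform (Z z) (Set.Icc 0 ζ) P
  measurable_X : ∀ k, Measurable (X k)
  law_X : ∀ z i s', P {ω | X (z, i) ω = s'} = ENNReal.ofReal (p z s')
  indep_Z : iIndepFun Z P
  indep_X : iIndepFun X P
  indep_Z_X : IndepFun (fun ω z => Z z ω) (fun ω k => X k ω) P

end PMBP

end

/-! For a fixed policy the error is Bernstein noise propagated by the empirical kernel. Write v for
the true value, u = v - v(s₀) and ε = β/(2n). One application of the empirical Bellman operator to v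
errs at s by γ(p̂ - p)·u, which is of order √(Var_p(u) ε). Minorization bounds the span of v by 2t
with t = t_minorize, the rewards lying in [0,2] (`value_sub_value_le_tMinorize`), so |u| ≤ B =
min(2t, 2/(1-γ)). Bounding each standard deviation by B would cost a factor t. The sharp √t comes
from a Lyapunov argument: by the Bellman equation Var_p(u) is at most a constant times γ p̂·u² - u²
plus O(B), once Bernstein's bound also holds for u² (`vecVar_le_of_rowClose`). Hence |v̂ - v| +
(8/κ)u² is a discounted subsolution for the empirical kernel, and a single use of the maximum
principle gives 19√(tε)/(1-γ) for a suitable κ (`abs_value_sub_le_sqrt_of_rowClose`).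

The greedy policy depends on the samples, so Bernstein's bound does not apply to its value directly.
To decouple it from the row of a pair z, stop the empirical process at z and pay w there: the new
process does not see that row. If w is within η/2 of the empirical action value of z, the optimality
gap survives as a strict gap (`HasGap.hasStrictGap_cut`), and a policy with a strict gap is unique
(`HasStrictGap.unique`). A grid of step η/2 contains a suitable w. Thus, given the other rows, there
is at most one candidate policy per grid point, and Bernstein's bound holds for each. Policies
optimal for the true kernel do not depend on the samples and add one candidate value function per
pair.

The union bound costs 2δ/3 and the gap event δ/3. The suboptimality bound follows from the error
bounds for π₀ and for the greedy policy, since the latter is optimal for the empirical kernel. -/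

namespace PMBP

/-! ### Discounted Bellman equations, optimality gaps and cut processes -/

section Discounted

variable {S A : Type*} [Fintype S]

/-- Each `k z` is a nonnegative vector of total mass at most one. -/
def IsSubKernel (k : S × A → S → ℝ) : Prop :=
  ∀ z, (∀ s', 0 ≤ k z s') ∧ ∑ s', k z s' ≤ 1

lemma IsTransitionKernel.isSubKernel {k : S × A → S → ℝ} (hk : IsTransitionKernel k) :
    IsSubKernel k := fun z => ⟨(hk z).1, (hk z).2.le⟩

/-- Discounted maximum principle. -/
lemma le_of_le_discounted {k : S → S → ℝ} (hk0 : ∀ s s', 0 ≤ k s s') (hk1 : ∀ s, ∑ s', k s s' ≤ 1)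
    {γ c : ℝ} (hγ0 : 0 ≤ γ) (hγ1 : γ < 1) (hc : 0 ≤ c) {f : S → ℝ}
    (hf : ∀ s, f s ≤ c ∨ f s ≤ (1 - γ) * c + γ * (k s ⬝ᵥ f)) (s : S) : f s ≤ c := by
  have : Nonempty S := ⟨s⟩
  -- At a maximum point t with f t > c ≥ 0, averaging cannot exceed f t; nonnegativity is what
  -- allows rows of mass below one. The second alternative then gives (1 - γ) f t ≤ (1 - γ) c.
  obtain ⟨t, ht⟩ := Finite.exists_max f
  refine (ht s).trans ?_
  rcases hf t with h | h
  · exact h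
  by_contra! hlt
  have h1 : k t ⬝ᵥ f ≤ f t := by
    calc k t ⬝ᵥ f ≤ ∑ s', k t s' * f t :=
          Finset.sum_le_sum fun s' _ => mul_le_mul_of_nonneg_left (ht s') (hk0 t s')
      _ = (∑ s', k t s') * f t := by rw [Finset.sum_mul]
      _ ≤ 1 * f t := mul_le_mul_of_nonneg_right (hk1 t) (hc.trans hlt.le)
      _ = f t := one_mul _
  nlinarith [mul_le_mul_of_nonneg_left h1 hγ0]

lemma abs_dotProduct_le {k : S → ℝ} (hk0 : ∀ s, 0 ≤ k s) (f : S → ℝ) :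
    |k ⬝ᵥ f| ≤ k ⬝ᵥ (fun s => |f s|) := by
  refine (Finset.abs_sum_le_sum_abs _ _).trans (le_of_eq ?_)
  exact Finset.sum_congr rfl fun s _ => by rw [abs_mul, abs_of_nonneg (hk0 s)]

/-- The maximum principle with c = 0, applied to |f - g|. It yields both the invertibility of I - γP
and the uniqueness of solutions of Bellman equations. -/
lemma eq_of_discounted {k : S → S → ℝ} (hk0 : ∀ s s', 0 ≤ k s s') (hk1 : ∀ s, ∑ s', k s s' ≤ 1)
    {γ : ℝ} (hγ0 : 0 ≤ γ) (hγ1 : γ < 1) {f g : S → ℝ}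
    (h : ∀ s, |f s - g s| ≤ γ * (k s ⬝ᵥ fun s' => |f s' - g s'|)) : f = g := by
  funext s
  have := le_of_le_discounted hk0 hk1 hγ0 hγ1 le_rfl (f := fun s => |f s - g s|)
    (fun s => Or.inr (by simpa using h s)) s
  exact sub_eq_zero.1 (abs_eq_zero.1 (le_antisymm this (abs_nonneg _)))

variable {γ : ℝ} {k : S × A → S → ℝ} {R : S × A → ℝ}

lemma lookahead_eq (v : S → ℝ) (z : S × A) : lookahead γ k R v z = R z + γ * (k z ⬝ᵥ v) := rfl

lemma abs_lookahead_sub_le (hk : IsSubKernel k) (hγ0 : 0 ≤ γ) (v w : S → ℝ) (z : S × A) :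
    |lookahead γ k R v z - lookahead γ k R w z| ≤ γ * (k z ⬝ᵥ fun s => |v s - w s|) := by
  have : lookahead γ k R v z - lookahead γ k R w z = γ * (k z ⬝ᵥ (v - w)) := by
    simp only [lookahead_eq, dotProduct_sub]; ring
  rw [this, abs_mul, abs_of_nonneg hγ0]
  exact mul_le_mul_of_nonneg_left (abs_dotProduct_le (hk z).1 _) hγ0

lemma dotProduct_le_of_le {q : S → ℝ} (hq0 : ∀ s, 0 ≤ q s) (hq1 : ∑ s, q s ≤ 1) {c : ℝ}
    (hc : 0 ≤ c) {f : S → ℝ} (hf : ∀ s, f s ≤ c) : q ⬝ᵥ f ≤ c := by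
  calc q ⬝ᵥ f ≤ ∑ s, q s * c := Finset.sum_le_sum fun s _ => mul_le_mul_of_nonneg_left (hf s) (hq0 s)
    _ = (∑ s, q s) * c := by rw [Finset.sum_mul]
    _ ≤ 1 * c := mul_le_mul_of_nonneg_right hq1 hc
    _ = c := one_mul c

lemma SolvesBellman.lookahead_le [Fintype A] [Nonempty A] {v : S → ℝ} (hv : SolvesBellman γ k R v) (s : S)
    (a : A) : lookahead γ k R v (s, a) ≤ v s := by
  rw [hv s]
  exact Finset.le_sup' (fun a => lookahead γ k R v (s, a)) (Finset.mem_univ a)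

variable [DecidableEq S]

lemma value_eq (hk : IsSubKernel k) (hγ0 : 0 ≤ γ) (hγ1 : γ < 1) (π : S → A) (s : S) :
    value γ k R π s = lookahead γ k R (value γ k R π) (s, π s) := by
  have hinj : Function.Injective (Matrix.mulVec (1 - γ • policyMatrix k π)) := by
    intro v w hvw
    refine eq_of_discounted (k := fun s => k (s, π s)) (fun s => (hk _).1) (fun s => (hk _).2)
      hγ0 hγ1 fun s => ?_
    have h := congrFun hvw s
    simp only [Matrix.sub_mulVec, Matrix.one_mulVec, Matrix.smul_mulVec, Pi.sub_apply,
      Pi.smul_apply, smul_eq_mul] at h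
    have h' : v s - w s = lookahead γ k R v (s, π s) - lookahead γ k R w (s, π s) := by
      simp only [lookahead_eq]
      change v s - γ * (k (s, π s) ⬝ᵥ v) = w s - γ * (k (s, π s) ⬝ᵥ w) at h
      linarith
    rw [h']
    exact abs_lookahead_sub_le hk hγ0 v w _
  have hu : IsUnit (1 - γ • policyMatrix k π) := Matrix.mulVec_injective_iff_isUnit.1 hinj
  have h1 : Matrix.mulVec (1 - γ • policyMatrix k π) (value γ k R π) = fun s => R (s, π s) := by
    rw [value, Matrix.mulVec_mulVec,
      Matrix.mul_nonsing_inv _ ((Matrix.isUnit_iff_isUnit_det _).1 hu), Matrix.one_mulVec]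
  have h := congrFun h1 s
  simp only [Matrix.sub_mulVec, Matrix.one_mulVec, Matrix.smul_mulVec, Pi.sub_apply,
      Pi.smul_apply, smul_eq_mul] at h
  change value γ k R π s - γ * (k (s, π s) ⬝ᵥ value γ k R π) = _ at h
  rw [lookahead_eq]; linarith

lemma eq_value (hk : IsSubKernel k) (hγ0 : 0 ≤ γ) (hγ1 : γ < 1) {π : S → A} {v : S → ℝ}
    (hv : ∀ s, v s = lookahead γ k R v (s, π s)) : v = value γ k R π := by
  refine eq_of_discounted (k := fun s => k (s, π s)) (fun s => (hk _).1) (fun s => (hk _).2)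
      hγ0 hγ1 fun s => ?_
  conv_lhs => rw [hv s, value_eq hk hγ0 hγ1]
  exact abs_lookahead_sub_le hk hγ0 _ _ _

/-- A vector dominating its one-step lookahead along `π` dominates the value of `π`. -/
lemma value_le (hk : IsSubKernel k) (hγ0 : 0 ≤ γ) (hγ1 : γ < 1) {π : S → A} {v : S → ℝ}
    (hv : ∀ s, lookahead γ k R v (s, π s) ≤ v s) (s : S) : value γ k R π s ≤ v s := by
  have := le_of_le_discounted (k := fun s => k (s, π s)) (fun s => (hk _).1) (fun s => (hk _).2)
    hγ0 hγ1 le_rfl (f := value γ k R π - v) (fun s => Or.inr ?_) s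
  · simpa using this
  have h1 := hv s
  have h2 := value_eq (R := R) hk hγ0 hγ1 π s
  simp only [lookahead_eq] at h1 h2
  simp only [dotProduct_sub, Pi.sub_apply]
  linarith

lemma value_nonneg (hk : IsSubKernel k) (hγ0 : 0 ≤ γ) (hγ1 : γ < 1) (hR : ∀ z, 0 ≤ R z)
    (π : S → A) (s : S) : 0 ≤ value γ k R π s := by
  have := le_of_le_discounted (k := fun s => k (s, π s)) (fun s => (hk _).1) (fun s => (hk _).2)
    hγ0 hγ1 le_rfl (f := - value γ k R π) (fun s => Or.inr ?_) s
  · simpa using this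
  have h2 := value_eq (R := R) hk hγ0 hγ1 π s
  have := hR (s, π s)
  simp only [lookahead_eq] at h2
  simp only [dotProduct_neg, Pi.neg_apply]
  linarith

lemma value_le_of_reward_le (hk : IsSubKernel k) (hγ0 : 0 ≤ γ) (hγ1 : γ < 1) {c : ℝ} (hc : 0 ≤ c)
    (hR : ∀ z, R z ≤ c) (π : S → A) (s : S) : value γ k R π s ≤ c / (1 - γ) := by
  have h1γ : 0 < 1 - γ := by linarith
  refine le_of_le_discounted (k := fun s => k (s, π s)) (fun s => (hk _).1) (fun s => (hk _).2)
    hγ0 hγ1 (by positivity) (f := value γ k R π) (fun s => Or.inr ?_) s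
  have h2 := value_eq (R := R) hk hγ0 hγ1 π s
  rw [lookahead_eq] at h2
  rw [mul_div_cancel₀ _ h1γ.ne', h2]
  have := hR (s, π s)
  linarith

/-- Every action other than the one prescribed by `π` is strictly worse. -/
def HasStrictGap (γ : ℝ) (k : S × A → S → ℝ) (R : S × A → ℝ) (π : S → A) : Prop :=
  ∀ s, ∀ b, b ≠ π s → 0 < value γ k R π s - actionValue γ k R π (s, b)

lemma HasGap.hasStrictGap {π : S → A} {η : ℝ} (hη : 0 < η) (h : HasGap γ k R π η) :
    HasStrictGap γ k R π := fun s b hb => hη.trans_le (h s b hb)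

lemma HasStrictGap.lookahead_le (hk : IsSubKernel k) (hγ0 : 0 ≤ γ) (hγ1 : γ < 1) {π : S → A}
    (h : HasStrictGap γ k R π) (s : S) (a : A) :
    lookahead γ k R (value γ k R π) (s, a) ≤ value γ k R π s := by
  by_cases ha : a = π s
  · subst ha; exact (value_eq hk hγ0 hγ1 π s).ge
  · exact (sub_pos.1 (h s a ha)).le

/-- The value of π dominates all its lookaheads, so no policy beats it and the two values coincide.
A state where the policies differ would then contradict the strict gap through the Bellman equation
of π'. -/
lemma HasStrictGap.eq_of_le (hk : IsSubKernel k) (hγ0 : 0 ≤ γ) (hγ1 : γ < 1) {π π' : S → A}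
    (h : HasStrictGap γ k R π) (h' : ∀ s, value γ k R π s ≤ value γ k R π' s) : π' = π := by
  have heq : value γ k R π' = value γ k R π := by
    funext s
    exact le_antisymm (value_le hk hγ0 hγ1 (fun s => h.lookahead_le hk hγ0 hγ1 s _) s) (h' s)
  funext s
  by_contra hne
  have h1 := h s (π' s) hne
  have h2 := value_eq (R := R) hk hγ0 hγ1 π' s
  rw [heq] at h2
  simp only [actionValue] at h1
  linarith

lemma HasStrictGap.unique (hk : IsSubKernel k) (hγ0 : 0 ≤ γ) (hγ1 : γ < 1) {π π' : S → A}
    (h : HasStrictGap γ k R π) (h' : HasStrictGap γ k R π') : π' = π :=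
  h.eq_of_le hk hγ0 hγ1 (value_le hk hγ0 hγ1 fun s => h'.lookahead_le hk hγ0 hγ1 s _)

lemma SolvesBellman.eq_value_greedy [Fintype A] [Nonempty A] (hk : IsSubKernel k) (hγ0 : 0 ≤ γ) (hγ1 : γ < 1)
    {v : S → ℝ} (hv : SolvesBellman γ k R v) {π : S → A} (hπ : IsGreedy γ k R v π) :
    v = value γ k R π := by
  refine eq_value hk hγ0 hγ1 fun s => le_antisymm ?_ (hv.lookahead_le s _)
  conv_lhs => rw [hv s]
  exact Finset.sup'_le _ _ fun a _ => hπ s a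

/-- A greedy policy for the Bellman solution has at least the value of any policy. -/
lemma SolvesBellman.value_le_greedy [Fintype A] [Nonempty A] (hk : IsSubKernel k) (hγ0 : 0 ≤ γ) (hγ1 : γ < 1)
    {v : S → ℝ} (hv : SolvesBellman γ k R v) {π : S → A} (hπ : IsGreedy γ k R v π) (π' : S → A)
    (s : S) : value γ k R π' s ≤ value γ k R π s := by
  rw [← hv.eq_value_greedy hk hγ0 hγ1 hπ]
  exact value_le hk hγ0 hγ1 (fun s => hv.lookahead_le s _) s

/-! ### Cutting out one state-action pair -/

open Classical in
/-- The kernel in which the process stops after the pair `z`. -/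
noncomputable def cutKernel (k : S × A → S → ℝ) (z : S × A) : S × A → S → ℝ := Function.update k z 0

open Classical in
/-- The reward in which the pair `z` earns `w`. -/
noncomputable def cutReward (R : S × A → ℝ) (z : S × A) (w : ℝ) : S × A → ℝ := Function.update R z w

lemma isSubKernel_cutKernel (hk : IsSubKernel k) (z : S × A) : IsSubKernel (cutKernel k z) := by
  intro z'
  classical
  by_cases h : z' = z
  · subst h; simp [cutKernel]
  · rw [cutKernel, Function.update_of_ne h]; exact hk z'

lemma lookahead_cut_self (z : S × A) (w : ℝ) (v : S → ℝ) :
    lookahead γ (cutKernel k z) (cutReward R z w) v z = w := by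
  simp [lookahead_eq, cutKernel, cutReward]

lemma lookahead_cut_of_ne {z z' : S × A} (h : z' ≠ z) (w : ℝ) (v : S → ℝ) :
    lookahead γ (cutKernel k z) (cutReward R z w) v z' = lookahead γ k R v z' := by
  classical
  simp only [lookahead_eq, cutKernel, cutReward]
  rw [Function.update_of_ne h, Function.update_of_ne h]

/-- If the pair `z` earns nearly its state-action value before the process is stopped there, then
a policy with an optimality gap keeps a strict gap. -/
lemma HasGap.hasStrictGap_cut (hk : IsSubKernel k) (hγ0 : 0 ≤ γ) (hγ1 : γ < 1) {π : S → A} {η : ℝ}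
    (h : HasGap γ k R π η) (z : S × A) {w : ℝ} (hw : 2 * |w - actionValue γ k R π z| < η) :
    HasStrictGap γ (cutKernel k z) (cutReward R z w) π := by
  set v := value γ k R π with hv
  set v' := value γ (cutKernel k z) (cutReward R z w) π with hv'
  set d := |w - actionValue γ k R π z| with hd
  have hk' := isSubKernel_cutKernel hk z
  have hd0 : 0 ≤ d := abs_nonneg _
  -- At z both lookaheads are explicit numbers at distance d; at every other pair the two processes
  -- share reward and kernel. This is the dichotomy that the maximum principle accepts.
  have key : ∀ s a, |lookahead γ (cutKernel k z) (cutReward R z w) v' (s, a) -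
      lookahead γ k R v (s, a)| ≤ d ∨
      |lookahead γ (cutKernel k z) (cutReward R z w) v' (s, a) - lookahead γ k R v (s, a)| ≤
        γ * (k (s, a) ⬝ᵥ fun s => |v' s - v s|) := by
    intro s a
    by_cases hz : (s, a) = z
    · left; rw [hz, lookahead_cut_self]; exact le_rfl
    · right; rw [lookahead_cut_of_ne hz]; exact abs_lookahead_sub_le hk hγ0 _ _ _
  have hclose : ∀ s, |v' s - v s| ≤ d := by
    refine le_of_le_discounted (k := fun s => k (s, π s)) (fun s => (hk _).1) (fun s => (hk _).2)
      hγ0 hγ1 hd0 fun s => ?_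
    have h1 : v' s = lookahead γ (cutKernel k z) (cutReward R z w) v' (s, π s) :=
      value_eq hk' hγ0 hγ1 π s
    have h2 : v s = lookahead γ k R v (s, π s) := value_eq hk hγ0 hγ1 π s
    rcases key s (π s) with h | h
    · left; rwa [← h1, ← h2] at h
    · right; rw [← h1, ← h2] at h
      nlinarith
  -- The value and the lookahead each move by at most d, so the gap loses at most 2d < η.
  intro s b hb
  have h1 := h s b hb
  have h2 : |lookahead γ (cutKernel k z) (cutReward R z w) v' (s, b) -
      lookahead γ k R v (s, b)| ≤ d := by
    rcases key s b with h | h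
    · exact h
    · have h3 := dotProduct_le_of_le (hk (s, b)).1 (hk (s, b)).2 hd0 hclose
      nlinarith
  have h4 := hclose s
  simp only [actionValue, ← hv, ← hv'] at h1 ⊢
  rw [abs_le] at h2 h4
  linarith

end Discounted

/-! ### Span of value functions and the minorization time -/

section Span

variable {S A : Type*} [Fintype S]

lemma dotProduct_le_sum_mul {q : S → ℝ} (hq0 : ∀ s, 0 ≤ q s) {c : ℝ} {f : S → ℝ}
    (hf : ∀ s, f s ≤ c) : q ⬝ᵥ f ≤ (∑ s, q s) * c := by
  rw [Finset.sum_mul]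
  exact Finset.sum_le_sum fun s _ => mul_le_mul_of_nonneg_left (hf s) (hq0 s)

lemma dotProduct_const {k : S → ℝ} (hk : ∑ s, k s = 1) (c : ℝ) : (k ⬝ᵥ fun _ => c) = c := by
  rw [dotProduct, ← Finset.sum_mul, hk, one_mul]

/-- Doeblin's argument: the common part q ψ cancels, and the two remainders are nonnegative vectors
of mass 1 - q. -/
lemma sub_le_of_minorized {q : ℝ} {ψ x y : S → ℝ} (hψ : ∑ s, ψ s = 1)
    (hx : ∀ s, q * ψ s ≤ x s) (hy : ∀ s, q * ψ s ≤ y s) (hx1 : ∑ s, x s = 1) (hy1 : ∑ s, y s = 1)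
    {f : S → ℝ} {D : ℝ} (hD : ∀ s s', f s - f s' ≤ D) : x ⬝ᵥ f - y ⬝ᵥ f ≤ (1 - q) * D := by
  have hS : Nonempty S := by
    by_contra h
    rw [not_nonempty_iff] at h
    simp at hψ
  obtain ⟨a, ha⟩ := Finite.exists_max f
  obtain ⟨b, hb⟩ := Finite.exists_min f
  have hsum : ∀ {z : S → ℝ}, ∑ s, z s = 1 → ∑ s, (z - q • ψ) s = 1 - q := by
    intro z hz
    simp only [Pi.sub_apply, Pi.smul_apply, smul_eq_mul, Finset.sum_sub_distrib, ← Finset.mul_sum,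
      hz, hψ, mul_one]
  have h1 := dotProduct_le_sum_mul (q := x - q • ψ) (fun s => by simpa using hx s) ha
  have h2 := dotProduct_le_sum_mul (q := y - q • ψ) (fun s => by simpa using hy s)
    (f := -f) (c := -f b) (fun s => by simpa using hb s)
  rw [hsum hx1] at h1
  rw [hsum hy1] at h2
  simp only [sub_dotProduct, dotProduct_neg] at h1 h2
  have h0 : 0 ≤ 1 - q := by
    rw [← hsum hx1]; exact Finset.sum_nonneg fun s _ => by simpa using hx s
  have := mul_le_mul_of_nonneg_left (hD a b) h0
  nlinarith

variable [DecidableEq S]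

lemma policyMatrix_pow_stochastic {p : S × A → S → ℝ} (hp : IsTransitionKernel p) (π : S → A)
    (j : ℕ) : (∀ s s', 0 ≤ (policyMatrix p π ^ j) s s') ∧
      ∀ s, ∑ s', (policyMatrix p π ^ j) s s' = 1 := by
  induction j with
  | zero =>
    refine ⟨fun s s' => ?_, fun s => ?_⟩
    · rw [pow_zero, Matrix.one_apply]; split_ifs <;> norm_num
    · simp [Matrix.one_apply]
  | succ j ih =>
    refine ⟨fun s s' => ?_, fun s => ?_⟩
    · rw [pow_succ, Matrix.mul_apply]
      exact Finset.sum_nonneg fun i _ => mul_nonneg (ih.1 _ _) ((hp _).1 _)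
    · simp only [pow_succ, Matrix.mul_apply]
      rw [Finset.sum_comm]
      simp only [← Finset.mul_sum]
      rw [← ih.2 s]
      exact Finset.sum_congr rfl fun i _ => by
        rw [show ∑ s', policyMatrix p π i s' = 1 from (hp (i, π i)).2, mul_one]

variable {γ : ℝ} {p : S × A → S → ℝ} {R : S × A → ℝ}

/-- The span of a value function is at most the span of the reward times `m / q`, for
any minorization pair `(m, q)`. -/
lemma value_sub_value_le (hp : IsTransitionKernel p) (hγ0 : 0 ≤ γ) (hγ1 : γ < 1) {c : ℝ}
    (hR : ∀ z, R z ∈ Set.Icc 0 c) {π : S → A} {m : ℕ} {q : ℝ}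
    (hm : Minorizes (policyMatrix p π) m q) (s s' : S) :
    value γ p R π s - value γ p R π s' ≤ c * (m / q) := by
  obtain ⟨hm1, hq0, hq1, ψ, hψ0, hψ1, hψ⟩ := hm
  have : Nonempty S := ⟨s⟩
  set v := value γ p R π with hv
  set M := policyMatrix p π with hM
  obtain ⟨a, ha⟩ := Finite.exists_max v
  obtain ⟨b, hb⟩ := Finite.exists_min v
  set g : S → ℝ := fun s => R (s, π s) with hg
  have hvM : v = g + γ • M.mulVec v := by
    funext s
    exact value_eq hp.isSubKernel hγ0 hγ1 π s
  have hc : 0 ≤ c := (hR (s, π s)).1.trans (hR (s, π s)).2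
  -- Unrolling the Bellman equation j times: each step contributes a reward difference of at most c.
  -- At j = m the remaining term is contracted by 1 - q, so q times the span is at most c m.
  have iter : ∀ j : ℕ, v a - v b ≤
      c * j + γ ^ j * ((M ^ j).mulVec v a - (M ^ j).mulVec v b) := by
    intro j
    induction j with
    | zero => simp
    | succ j ih =>
      have hstep : ∀ t, (M ^ j).mulVec v t = (M ^ j).mulVec g t + γ * (M ^ (j + 1)).mulVec v t := by
        intro t
        conv_lhs => rw [hvM]
        rw [Matrix.mulVec_add, Matrix.mulVec_smul, Matrix.mulVec_mulVec, ← pow_succ]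
        rfl
      obtain ⟨h0, h1⟩ := policyMatrix_pow_stochastic hp π j
      have hga : (M ^ j).mulVec g a ≤ c :=
        dotProduct_le_of_le (h0 a) (h1 a).le hc fun s => (hR _).2
      have hgb : 0 ≤ (M ^ j).mulVec g b :=
        Finset.sum_nonneg fun i _ => mul_nonneg (h0 _ _) (hR _).1
      have hγj : γ ^ j * ((M ^ j).mulVec g a - (M ^ j).mulVec g b) ≤ c := by
        have h2 : γ ^ j ≤ 1 := pow_le_one₀ hγ0 hγ1.le
        have h3 : 0 ≤ γ ^ j := pow_nonneg hγ0 j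
        nlinarith
      rw [hstep a, hstep b] at ih
      push_cast
      rw [pow_succ γ]
      linarith
  have hfin := iter m
  obtain ⟨h0, h1⟩ := policyMatrix_pow_stochastic hp π m
  have hD : ∀ s s', v s - v s' ≤ v a - v b := fun s s' => by linarith [ha s, hb s']
  have hmin : (M ^ m).mulVec v a - (M ^ m).mulVec v b ≤ (1 - q) * (v a - v b) :=
    sub_le_of_minorized hψ1 (hψ a) (hψ b) (h1 a) (h1 b) hD
  have hab : 0 ≤ v a - v b := by linarith [ha b]
  have hγm : γ ^ m * ((M ^ m).mulVec v a - (M ^ m).mulVec v b) ≤ (1 - q) * (v a - v b) := by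
    have h2 : γ ^ m ≤ 1 := pow_le_one₀ hγ0 hγ1.le
    have h3 : 0 ≤ γ ^ m := pow_nonneg hγ0 m
    have h4 : 0 ≤ (1 - q) * (v a - v b) := mul_nonneg (by linarith) hab
    nlinarith
  refine (hD s s').trans ?_
  rw [← mul_div_assoc, le_div_iff₀ hq0]
  linarith

lemma one_le_of_minorizes {M : Matrix S S ℝ} {m : ℕ} {q : ℝ} (h : Minorizes M m q) :
    (1 : ℝ) ≤ m / q := by
  rw [le_div_iff₀ h.2.1, one_mul]
  exact h.2.2.1.trans (by exact_mod_cast h.1)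

lemma le_tMinorize [Finite A] (π : S → A) :
    minorizationTime (policyMatrix p π) ≤ tMinorize p :=
  le_ciSup (f := fun π : S → A => minorizationTime (policyMatrix p π)) (Set.finite_range _).bddAbove π

lemma one_le_tMinorize [Finite A] [Nonempty A] (herg : UniformlyErgodic p) : 1 ≤ tMinorize p := by
  obtain ⟨a⟩ := ‹Nonempty A›
  refine le_trans ?_ (le_tMinorize fun _ => a)
  obtain ⟨m, q, h⟩ := herg fun _ => a
  refine le_csInf ⟨_, m, q, h, rfl⟩ ?_
  rintro _ ⟨m, q, h, rfl⟩
  exact one_le_of_minorizes h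

lemma value_sub_value_le_tMinorize [Finite A] (hp : IsTransitionKernel p)
    (herg : UniformlyErgodic p) (hγ0 : 0 ≤ γ) (hγ1 : γ < 1) {c : ℝ} (hc : 0 < c)
    (hR : ∀ z, R z ∈ Set.Icc 0 c) (π : S → A) (s s' : S) :
    value γ p R π s - value γ p R π s' ≤ c * tMinorize p := by
  refine le_trans ?_ (mul_le_mul_of_nonneg_left (le_tMinorize π) hc.le)
  rw [← div_le_iff₀' hc]
  obtain ⟨m, q, h⟩ := herg π
  refine le_csInf ⟨_, m, q, h, rfl⟩ ?_
  rintro _ ⟨m, q, h, rfl⟩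
  rw [div_le_iff₀' hc]
  exact value_sub_value_le hp hγ0 hγ1 hR h s s'

end Span

/-! ### Deterministic error bound through a variance Lyapunov function -/

section Error

variable {S A : Type*} [Fintype S]

/-- The variance of `f` under the probability vector `k`. -/
def vecVar (k f : S → ℝ) : ℝ := k ⬝ᵥ fun s => (f s - k ⬝ᵥ f) ^ 2

lemma vecVar_nonneg {k : S → ℝ} (hk : ∀ s, 0 ≤ k s) (f : S → ℝ) : 0 ≤ vecVar k f :=
  Finset.sum_nonneg fun s _ => mul_nonneg (hk s) (sq_nonneg _)

lemma dotProduct_sub_sq {k : S → ℝ} (hk : ∑ s, k s = 1) (f : S → ℝ) (c : ℝ) :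
    (k ⬝ᵥ fun s => (f s - c) ^ 2) = vecVar k f + (k ⬝ᵥ f - c) ^ 2 := by
  have h : ∀ d : ℝ, (k ⬝ᵥ fun s => (f s - d) ^ 2) =
      (k ⬝ᵥ fun s => f s ^ 2) - 2 * d * (k ⬝ᵥ f) + d ^ 2 := by
    intro d
    have : ∀ s, k s * (f s - d) ^ 2 = k s * f s ^ 2 - 2 * d * (k s * f s) + k s * d ^ 2 :=
      fun s => by ring
    simp only [dotProduct, this, Finset.sum_add_distrib, Finset.sum_sub_distrib, ← Finset.mul_sum,
      ← Finset.sum_mul, hk, one_mul]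
  rw [vecVar, h, h]; ring

lemma dotProduct_sq {k : S → ℝ} (hk : ∑ s, k s = 1) (f : S → ℝ) :
    (k ⬝ᵥ fun s => f s ^ 2) = vecVar k f + (k ⬝ᵥ f) ^ 2 := by
  simpa using dotProduct_sub_sq hk f 0

lemma abs_dotProduct_le_of_abs_le {k : S → ℝ} (hk0 : ∀ s, 0 ≤ k s) (hk1 : ∑ s, k s = 1) {f : S → ℝ}
    {B : ℝ} (hf : ∀ s, |f s| ≤ B) : |k ⬝ᵥ f| ≤ B := by
  refine (abs_dotProduct_le hk0 f).trans ?_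
  simpa [hk1] using dotProduct_le_sum_mul hk0 hf

/-- Squaring a vector bounded by `B` multiplies its standard deviation by at most `2 B`. -/
lemma vecVar_sq_le {k : S → ℝ} (hk0 : ∀ s, 0 ≤ k s) (hk1 : ∑ s, k s = 1) {f : S → ℝ} {B : ℝ}
    (hf : ∀ s, |f s| ≤ B) : vecVar k (fun s => f s ^ 2) ≤ (2 * B) ^ 2 * vecVar k f := by
  have h1 := dotProduct_sub_sq hk1 (fun s => f s ^ 2) ((k ⬝ᵥ f) ^ 2)
  have h2 : (k ⬝ᵥ fun s => (f s ^ 2 - (k ⬝ᵥ f) ^ 2) ^ 2) ≤ (2 * B) ^ 2 * vecVar k f := by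
    rw [vecVar, ← smul_eq_mul, ← dotProduct_smul]
    refine Finset.sum_le_sum fun s _ => ?_
    have h3 : (f s + k ⬝ᵥ f) ^ 2 ≤ (2 * B) ^ 2 := by
      rw [← sq_abs]
      have := abs_add_le (f s) (k ⬝ᵥ f)
      have := abs_dotProduct_le_of_abs_le hk0 hk1 hf
      have := hf s
      exact pow_le_pow_left₀ (abs_nonneg _) (by linarith) 2
    have h4 := mul_le_mul_of_nonneg_left h3 (mul_nonneg (hk0 s) (sq_nonneg (f s - k ⬝ᵥ f)))
    calc _ = k s * (f s - k ⬝ᵥ f) ^ 2 * (f s + k ⬝ᵥ f) ^ 2 := by ring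
      _ ≤ _ := h4
      _ = _ := by simp only [Pi.smul_apply, smul_eq_mul]; ring
  nlinarith [sq_nonneg ((k ⬝ᵥ fun s => f s ^ 2) - (k ⬝ᵥ f) ^ 2)]

variable [DecidableEq S] {γ : ℝ} {p k : S × A → S → ℝ} {R : S × A → ℝ}

/-- Along the row of `z`, the vector `u` and its square have means under `p z` and `k z`
that differ by at most Bernstein's bound. -/
def RowClose (p k u : S → ℝ) (B ε : ℝ) : Prop :=
  |k ⬝ᵥ u - p ⬝ᵥ u| ≤ 2 * √(vecVar p u * ε) + B * ε ∧
    |(k ⬝ᵥ fun s => u s ^ 2) - (p ⬝ᵥ fun s => u s ^ 2)| ≤ 4 * B * √(vecVar p u * ε) + B ^ 2 * ε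

lemma two_mul_sqrt_mul_le {V ε κ : ℝ} (hV : 0 ≤ V) (hε : 0 ≤ ε) (hκ : 0 < κ) :
    2 * √(V * ε) ≤ V / κ + κ * ε := by
  have h1 : √(V * ε) = √(V / κ) * √(κ * ε) := by
    rw [← Real.sqrt_mul (by positivity)]; congr 1; field_simp
  have h2 := Real.sq_sqrt (show 0 ≤ V / κ by positivity)
  have h3 := Real.sq_sqrt (show 0 ≤ κ * ε by positivity)
  nlinarith [sq_nonneg (√(V / κ) - √(κ * ε))]

/-- The variance of the centred value function is, up to small terms, a discounted
increment of its square under the perturbed kernel. -/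
lemma vecVar_le_of_rowClose (hp : IsTransitionKernel p)
    (hγ : γ ∈ Set.Ico (1 / 2 : ℝ) 1) (hR : ∀ z, R z ∈ Set.Icc (0 : ℝ) 2) (π : S → A) (s₀ : S)
    {B ε : ℝ} (hε : 0 ≤ ε) {u : S → ℝ} (hu : ∀ s, u s = value γ p R π s - value γ p R π s₀)
    (hB : ∀ s, |u s| ≤ B) {s : S} (h : RowClose (p (s, π s)) (k (s, π s)) u B ε) :
    vecVar (p (s, π s)) u ≤
      8 * (γ * (k (s, π s) ⬝ᵥ fun s => u s ^ 2) - u s ^ 2 + 33 * B ^ 2 * ε + 4 * B) := by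
  obtain ⟨hγ0, hγ1⟩ := hγ
  have hγ0' : 0 ≤ γ := by linarith
  set P := p (s, π s) with hP
  set K := k (s, π s) with hK
  have hB0 : 0 ≤ B := (abs_nonneg _).trans (hB s)
  have hV := vecVar_nonneg (hp (s, π s)).1 u
  rw [← hP] at hV
  set V := vecVar P u with hVdef
  set c := value γ p R π s₀ with hc
  have hv := value_eq (R := R) hp.isSubKernel hγ0' hγ1 π s
  rw [lookahead_eq, ← hP] at hv
  have hc0 : 0 ≤ c := value_nonneg hp.isSubKernel hγ0' hγ1 (fun z => (hR z).1) π s₀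
  -- Centring replaces the reward by g = R - (1 - γ)c, which stays bounded by 2 independently of γ.
  have hc2 : (1 - γ) * c ≤ 2 := by
    have := value_le_of_reward_le hp.isSubKernel hγ0' hγ1 zero_le_two (fun z => (hR z).2) π s₀
    rwa [← hc, le_div_iff₀ (by linarith), mul_comm] at this
  have hPv : P ⬝ᵥ value γ p R π = P ⬝ᵥ u + c := by
    have : value γ p R π = u + fun _ => c := by funext s; simp [hu]
    rw [this, dotProduct_add, dotProduct_const (hp (s, π s)).2]
  have hus : u s = (R (s, π s) - (1 - γ) * c) + γ * (P ⬝ᵥ u) := by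
    rw [hu s, hv, hPv]; ring
  set g := R (s, π s) - (1 - γ) * c with hg
  have hg2 : |g| ≤ 2 := by
    rw [abs_le]
    have := hR (s, π s)
    have : 0 ≤ (1 - γ) * c := mul_nonneg (by linarith) hc0
    constructor <;> linarith [(hR (s, π s)).1, (hR (s, π s)).2]
  have hug : u s * g ≤ 2 * B := by
    calc u s * g ≤ |u s| * |g| := by rw [← abs_mul]; exact le_abs_self _
      _ ≤ B * 2 := mul_le_mul (hB s) hg2 (abs_nonneg _) hB0
      _ = 2 * B := by ring
  have hsq := dotProduct_sq (hp (s, π s)).2 u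
  rw [← hP, ← hVdef] at hsq
  have hP2 : 0 ≤ P ⬝ᵥ fun s => u s ^ 2 :=
    Finset.sum_nonneg fun i _ => mul_nonneg ((hp _).1 _) (sq_nonneg _)
  have hamgm : 4 * B * √(V * ε) ≤ V / 8 + 32 * B ^ 2 * ε := by
    have h1 : √(V * ε) ^ 2 = V * ε := Real.sq_sqrt (mul_nonneg hV hε)
    by_cases hB' : B = 0
    · simp [hB']; positivity
    · have hBpos : 0 < B := lt_of_le_of_ne hB0 (Ne.symm hB')
      -- With 16B the variance term becomes V/8. This is half of the V/4 gained below from γ ≥ 1/2,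
      -- which leaves V/8 and explains the factor 8 in the conclusion.
      have h2 := two_mul_sqrt_mul_le hV hε (κ := 16 * B) (by positivity)
      have h3 := mul_le_mul_of_nonneg_left h2 (show 0 ≤ 2 * B by positivity)
      have h4 : 2 * B * (V / (16 * B) + 16 * B * ε) = V / 8 + 32 * B ^ 2 * ε := by
        field_simp; ring
      linarith
  have hdiff : (P ⬝ᵥ fun s => u s ^ 2) ≤ (K ⬝ᵥ fun s => u s ^ 2) + V / 8 + 33 * B ^ 2 * ε := by
    have := (abs_le.1 h.2).1
    linarith
  -- Since γ P·u = u - g, one has γ²V = γ² P·u² - (u - g)². Expanding the square costs 2ug ≤ 4B, and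
  -- -g² is dropped.
  have hbase : γ ^ 2 * V ≤ γ * (P ⬝ᵥ fun s => u s ^ 2) - u s ^ 2 + 4 * B := by
    have e1 : γ ^ 2 * V = γ ^ 2 * (P ⬝ᵥ fun s => u s ^ 2) - (u s - g) ^ 2 := by
      rw [hsq]
      have : u s - g = γ * (P ⬝ᵥ u) := by linarith
      rw [this]; ring
    have e2 : γ ^ 2 * (P ⬝ᵥ fun s => u s ^ 2) ≤ γ * (P ⬝ᵥ fun s => u s ^ 2) :=
      mul_le_mul_of_nonneg_right (by nlinarith) hP2
    nlinarith [sq_nonneg g]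
  have hγ2 : V / 4 ≤ γ ^ 2 * V := by nlinarith [mul_nonneg hV (sub_nonneg.2 hγ0)]
  have hfin : γ * (P ⬝ᵥ fun s => u s ^ 2) ≤
      γ * (K ⬝ᵥ fun s => u s ^ 2) + (V / 8 + 33 * B ^ 2 * ε) := by
    have h5 := mul_le_mul_of_nonneg_left hdiff hγ0'
    have h6 : 0 ≤ V / 8 + 33 * B ^ 2 * ε := by positivity
    nlinarith
  linarith

/-- Error of the value of a policy when the kernel is replaced by one that is close to it along
the policy. -/
lemma abs_value_sub_le_of_rowClose (hp : IsTransitionKernel p) (hk : IsTransitionKernel k)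
    (hγ : γ ∈ Set.Ico (1 / 2 : ℝ) 1) (hR : ∀ z, R z ∈ Set.Icc (0 : ℝ) 2) (π : S → A) (s₀ : S)
    {B ε κ : ℝ} (hε : 0 ≤ ε) (hκ : 0 < κ) {u : S → ℝ}
    (hu : ∀ s, u s = value γ p R π s - value γ p R π s₀)
    (hB : ∀ s, |u s| ≤ B) (h : ∀ s, RowClose (p (s, π s)) (k (s, π s)) u B ε) (s : S) :
    |value γ k R π s - value γ p R π s| ≤
      (8 * (33 * B ^ 2 * ε + 4 * B) / κ + κ * ε + B * ε) / (1 - γ) := by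
  have hγ0 : 0 ≤ γ := by linarith [hγ.1]
  have h1γ : 0 < 1 - γ := by linarith [hγ.2]
  have hB0 : 0 ≤ B := (abs_nonneg _).trans (hB s)
  set K := 8 * (33 * B ^ 2 * ε + 4 * B) / κ + κ * ε + B * ε with hK
  have hK0 : 0 ≤ K := by positivity
  set d : S → ℝ := fun s => |value γ k R π s - value γ p R π s| with hd
  -- AM-GM turns the standard deviation into Var/κ + κε; adding (8/κ)u² to the error absorbs the
  -- discounted increment of u² that bounds Var/κ.
  have key := le_of_le_discounted (k := fun s => k (s, π s)) (fun s => (hk _).1)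
    (fun s => (hk _).2.le) hγ0 hγ.2 (c := K / (1 - γ)) (by positivity)
    (f := d + (8 / κ) • fun s => u s ^ 2) (fun s => Or.inr ?_) s
  · refine le_trans ?_ key
    simp only [Pi.add_apply, Pi.smul_apply, smul_eq_mul]
    have : 0 ≤ 8 / κ * u s ^ 2 := by positivity
    linarith
  · rw [mul_div_cancel₀ _ h1γ.ne']
    simp only [Pi.add_apply, Pi.smul_apply, smul_eq_mul, dotProduct_add, dotProduct_smul]
    have h1 := vecVar_le_of_rowClose hp hγ hR π s₀ hε hu hB (h s)
    have h2 := value_eq (R := R) hk.isSubKernel hγ0 hγ.2 π s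
    have h3 := value_eq (R := R) hp.isSubKernel hγ0 hγ.2 π s
    have h4 := abs_lookahead_sub_le (R := R) hk.isSubKernel hγ0 (value γ k R π) (value γ p R π)
      (s, π s)
    -- Both rows have mass one, so the constant v(s₀) cancels and v may be replaced by u.
    have h5 : lookahead γ k R (value γ p R π) (s, π s) - value γ p R π s =
        γ * (k (s, π s) ⬝ᵥ u - p (s, π s) ⬝ᵥ u) := by
      have : u = value γ p R π - fun _ => value γ p R π s₀ := by funext s; simp [hu]
      rw [this, dotProduct_sub, dotProduct_sub, dotProduct_const (hk _).2, dotProduct_const (hp _).2]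
      conv_lhs => rw [h3]
      simp only [lookahead_eq]
      ring
    have h6 : |lookahead γ k R (value γ p R π) (s, π s) - value γ p R π s| ≤
        2 * √(vecVar (p (s, π s)) u * ε) + B * ε := by
      rw [h5, abs_mul, abs_of_nonneg hγ0]
      have := (h s).1
      have h7 := abs_nonneg (k (s, π s) ⬝ᵥ u - p (s, π s) ⬝ᵥ u)
      nlinarith [hγ.2]
    have h8 : d s ≤ γ * (k (s, π s) ⬝ᵥ d) + (2 * √(vecVar (p (s, π s)) u * ε) + B * ε) := by
      have := abs_sub_le (value γ k R π s) (lookahead γ k R (value γ p R π) (s, π s))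
        (value γ p R π s)
      rw [← h2] at h4
      exact this.trans (add_le_add h4 h6)
    have h9 := two_mul_sqrt_mul_le (vecVar_nonneg (hp (s, π s)).1 u) hε hκ
    have h10 := div_le_div_of_nonneg_right h1 hκ.le
    have h11 : 8 * (γ * (k (s, π s) ⬝ᵥ fun s => u s ^ 2) - u s ^ 2 + 33 * B ^ 2 * ε + 4 * B) / κ =
        8 / κ * (γ * (k (s, π s) ⬝ᵥ fun s => u s ^ 2)) - 8 / κ * u s ^ 2 +
          8 * (33 * B ^ 2 * ε + 4 * B) / κ := by ring
    rw [hK]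
    nlinarith

/-- The error bound with its constant. -/
lemma abs_value_sub_le_sqrt_of_rowClose (hp : IsTransitionKernel p) (hk : IsTransitionKernel k)
    (hγ : γ ∈ Set.Ico (1 / 2 : ℝ) 1) (hR : ∀ z, R z ∈ Set.Icc (0 : ℝ) 2) (π : S → A) (s₀ : S)
    {B ε t : ℝ} (hε : 0 < ε) (ht : 0 < t) {u : S → ℝ}
    (hu : ∀ s, u s = value γ p R π s - value γ p R π s₀)
    (hB : ∀ s, |u s| ≤ B) (hBt : B ≤ 2 * t) (hBε : B * ε ≤ 1 / 64)
    (h : ∀ s, RowClose (p (s, π s)) (k (s, π s)) u B ε) (s : S) :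
    |value γ k R π s - value γ p R π s| ≤ 19 * √(t * ε) / (1 - γ) := by
  have h1γ : 0 < 1 - γ := by linarith [hγ.2]
  have hB0 : 0 ≤ B := (abs_nonneg _).trans (hB s)
  set y := √(t * ε) with hy
  have hy0 : 0 < y := Real.sqrt_pos.2 (by positivity)
  have hy2 : y ^ 2 = t * ε := Real.sq_sqrt (by positivity)
  -- The choice κ = 9t/y makes κε = 9y. As Bε ≤ 1/64 and B ≤ 2t, the first term has numerator below
  -- 81t and is at most 9y; the last is at most y, so the total is 19y.
  refine (abs_value_sub_le_of_rowClose hp hk hγ hR π s₀ hε.le (κ := 9 * t / y) (by positivity)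
    hu hB h s).trans ?_
  refine div_le_div_of_nonneg_right ?_ h1γ.le
  have e1 : 8 * (33 * B ^ 2 * ε + 4 * B) / (9 * t / y) ≤ 9 * y := by
    rw [div_le_iff₀ (by positivity)]
    have : 9 * y * (9 * t / y) = 81 * t := by field_simp; ring
    rw [this]
    nlinarith
  have e2 : 9 * t / y * ε = 9 * y := by
    field_simp; linarith
  have e3 : B * ε ≤ y := by
    refine le_of_sq_le_sq ?_ hy0.le
    rw [hy2]
    nlinarith [mul_nonneg hB0 hε.le]
  linarith

end Error

/-! ### Finite weighted sets: union bound and Markov's inequality -/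

section Mass

variable {α : Type*} [Fintype α]

/-- The mass of the set `F` under the weights `w`. -/
noncomputable def mass (w : α → ℝ) (F : Set α) : ℝ := ∑ a, F.indicator w a

variable {w : α → ℝ}

lemma mass_mono (hw : ∀ a, 0 ≤ w a) {F G : Set α} (h : F ⊆ G) : mass w F ≤ mass w G :=
  Finset.sum_le_sum fun a _ => Set.indicator_le_indicator_of_subset h hw a

lemma mass_empty : mass w ∅ = 0 := by simp [mass]

lemma mass_union_le (hw : ∀ a, 0 ≤ w a) (F G : Set α) : mass w (F ∪ G) ≤ mass w F + mass w G := by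
  rw [mass, mass, mass, ← Finset.sum_add_distrib]
  refine Finset.sum_le_sum fun a _ => ?_
  have := hw a
  by_cases hF : a ∈ F <;> by_cases hG : a ∈ G <;> simp [hF, hG, this]

lemma mass_biUnion_le {ι : Type*} (hw : ∀ a, 0 ≤ w a) (I : Finset ι) (F : ι → Set α) :
    mass w (⋃ i ∈ I, F i) ≤ ∑ i ∈ I, mass w (F i) := by
  classical
  induction I using Finset.induction_on with
  | empty => simp [mass_empty]
  | insert i I hi ih =>
    rw [Finset.set_biUnion_insert, Finset.sum_insert hi]
    exact (mass_union_le hw _ _).trans (by gcongr)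

/-- Markov's inequality for an exponential. -/
lemma mass_lt_le_sum_exp (hw : ∀ a, 0 ≤ w a) (g : α → ℝ) (c : ℝ) {l : ℝ} (hl : 0 ≤ l) :
    mass w {a | c < g a} ≤ Real.exp (-(l * c)) * ∑ a, w a * Real.exp (l * g a) := by
  rw [mass, Finset.mul_sum]
  refine Finset.sum_le_sum fun a _ => ?_
  by_cases h : a ∈ {a | c < g a}
  · rw [Set.indicator_of_mem h]
    have : 1 ≤ Real.exp (-(l * c)) * Real.exp (l * g a) := by
      rw [← Real.exp_add, ← Real.exp_zero]
      refine Real.exp_le_exp.2 ?_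
      have : c < g a := h
      nlinarith
    nlinarith [hw a]
  · rw [Set.indicator_of_notMem h]
    have := hw a
    positivity

end Mass

/-! ### Bernstein's inequality for empirical rows -/

section Bernstein

variable {S : Type*}

/-- The empirical distribution of the sample `y`. -/
noncomputable def empRow [DecidableEq S] {n : ℕ} (y : Fin n → S) : S → ℝ :=
  fun s' => (1 / (n : ℝ)) * ∑ i : Fin n, if y i = s' then 1 else 0

lemma empRow_nonneg [DecidableEq S] {n : ℕ} (y : Fin n → S) (s : S) : 0 ≤ empRow y s := by
  unfold empRow
  have : ∀ i, (0 : ℝ) ≤ if y i = s then 1 else 0 := fun i => by split_ifs <;> norm_num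
  exact mul_nonneg (by positivity) (Finset.sum_nonneg fun i _ => this i)

variable [Fintype S]

lemma sum_prod_mul_exp_sum {n : ℕ} (k f : S → ℝ) (l : ℝ) :
    ∑ y : Fin n → S, (∏ i, k (y i)) * Real.exp (l * ∑ i, f (y i)) =
      (∑ s, k s * Real.exp (l * f s)) ^ n := by
  classical
  have h : (∑ s, k s * Real.exp (l * f s)) ^ n =
      ∏ _i : Fin n, ∑ s, k s * Real.exp (l * f s) := by simp
  rw [h, Finset.prod_univ_sum, Fintype.piFinset_univ]
  refine Finset.sum_congr rfl fun y _ => ?_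
  rw [Finset.mul_sum, Real.exp_sum, ← Finset.prod_mul_distrib]

/-- The moment generating function of a centred bounded vector. -/
lemma sum_mul_exp_le {k : S → ℝ} (hk0 : ∀ s, 0 ≤ k s) (hk1 : ∑ s, k s = 1) {f : S → ℝ} {b l : ℝ}
    (hl : 0 ≤ l) (hlb : l * b ≤ 1) (hf : ∀ s, |f s| ≤ b) (hf0 : k ⬝ᵥ f = 0) :
    ∑ s, k s * Real.exp (l * f s) ≤ Real.exp (l ^ 2 * (k ⬝ᵥ fun s => f s ^ 2)) := by
  -- Uses exp x ≤ 1 + x + x² for |x| ≤ 1.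
  have h1 : ∀ s, k s * Real.exp (l * f s) ≤ k s + l * (k s * f s) + l ^ 2 * (k s * f s ^ 2) := by
    intro s
    have hb : |l * f s| ≤ 1 := by
      rw [abs_mul, abs_of_nonneg hl]
      exact (mul_le_mul_of_nonneg_left (hf s) hl).trans hlb
    have := (abs_le.1 (Real.abs_exp_sub_one_sub_id_le hb)).2
    nlinarith [hk0 s]
  refine (Finset.sum_le_sum fun s _ => h1 s).trans ?_
  rw [Finset.sum_add_distrib, Finset.sum_add_distrib, ← Finset.mul_sum, ← Finset.mul_sum, hk1]
  change 1 + l * (k ⬝ᵥ f) + l ^ 2 * (k ⬝ᵥ fun s => f s ^ 2) ≤ _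
  rw [hf0]
  have := Real.add_one_le_exp (l ^ 2 * (k ⬝ᵥ fun s => f s ^ 2))
  linarith

/-- Here σ is the standard deviation and e = √ε. The choice e/σ works while it respects l b ≤ 1;
otherwise σ ≤ b e, and the boundary value 1/b suffices because of the linear term b e². -/
lemma exists_chernoff_parameter {σ e b : ℝ} (hσ : 0 ≤ σ) (he : 0 ≤ e) (hb : 0 < b) :
    ∃ l : ℝ, 0 ≤ l ∧ l * b ≤ 1 ∧ l ^ 2 * σ ^ 2 - l * (2 * σ * e + b * e ^ 2) ≤ -e ^ 2 := by
  by_cases h : b * e ≤ σ ∧ 0 < σ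
  · obtain ⟨h, hσ'⟩ := h
    refine ⟨e / σ, by positivity, ?_, ?_⟩
    · rw [div_mul_eq_mul_div, div_le_one hσ']; linarith
    · have h1 : e / σ * σ = e := div_mul_cancel₀ _ hσ'.ne'
      have h2 : (e / σ) ^ 2 * σ ^ 2 = e ^ 2 := by rw [← mul_pow, h1]
      have h3 : e / σ * (2 * σ * e + b * e ^ 2) = 2 * e ^ 2 + e / σ * (b * e ^ 2) := by
        field_simp
      rw [h2, h3]
      have : 0 ≤ e / σ * (b * e ^ 2) := by positivity
      linarith
  · have h' : σ ≤ b * e := by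
      by_contra! h2
      exact h ⟨h2.le, lt_of_le_of_lt (by positivity) h2⟩
    refine ⟨1 / b, by positivity, by field_simp; rfl, ?_⟩
    have h1 : (1 / b) ^ 2 * σ ^ 2 - 1 / b * (2 * σ * e + b * e ^ 2) + e ^ 2 =
        σ * (σ - 2 * (b * e)) / b ^ 2 := by field_simp; ring
    have h2 : σ * (σ - 2 * (b * e)) / b ^ 2 ≤ 0 := by
      refine div_nonpos_of_nonpos_of_nonneg (mul_nonpos_of_nonneg_of_nonpos hσ ?_) (by positivity)
      have : 0 ≤ b * e := by positivity
      linarith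
    linarith

lemma vecVar_neg (k f : S → ℝ) : vecVar k (-f) = vecVar k f := by
  simp only [vecVar, dotProduct_neg, Pi.neg_apply]
  congr 1; funext s; ring

variable [DecidableEq S]

lemma empRow_dotProduct {n : ℕ} (y : Fin n → S) (f : S → ℝ) :
    empRow y ⬝ᵥ f = (1 / (n : ℝ)) * ∑ i, f (y i) := by
  simp only [empRow, dotProduct, mul_assoc, ← Finset.mul_sum, Finset.sum_mul]
  rw [Finset.sum_comm]
  simp

lemma sum_empRow {n : ℕ} (hn : 0 < n) (y : Fin n → S) : ∑ s, empRow y s = 1 := by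
  have := empRow_dotProduct y 1
  simp only [dotProduct_one, Pi.one_apply, Finset.sum_const, Finset.card_univ, Fintype.card_fin,
    nsmul_eq_mul, mul_one] at this
  rw [this]
  field_simp

lemma mass_bernstein_upper {n : ℕ} (hn : 0 < n) {k : S → ℝ} (hk0 : ∀ s, 0 ≤ k s)
    (hk1 : ∑ s, k s = 1) {f : S → ℝ} {b ε : ℝ} (hb : 0 < b) (hε : 0 ≤ ε)
    (hf : ∀ s, |f s - k ⬝ᵥ f| ≤ b) :
    mass (fun y : Fin n → S => ∏ i, k (y i))
      {y | 2 * √(vecVar k f * ε) + b * ε < empRow y ⬝ᵥ f - k ⬝ᵥ f} ≤ Real.exp (-(n * ε)) := by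
  have hV := vecVar_nonneg hk0 f
  obtain ⟨l, hl0, hlb, hl⟩ := exists_chernoff_parameter (Real.sqrt_nonneg (vecVar k f))
    (Real.sqrt_nonneg ε) hb
  rw [Real.sq_sqrt hV, Real.sq_sqrt hε, mul_assoc 2, ← Real.sqrt_mul hV] at hl
  set τ := 2 * √(vecVar k f * ε) + b * ε with hτ
  have hn' : (0 : ℝ) < n := by exact_mod_cast hn
  set g : S → ℝ := fun s => f s - k ⬝ᵥ f with hg
  have hg0 : k ⬝ᵥ g = 0 := by
    have : g = f - fun _ => k ⬝ᵥ f := rfl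
    rw [this, dotProduct_sub, dotProduct_const hk1, sub_self]
  have hset : {y : Fin n → S | τ < empRow y ⬝ᵥ f - k ⬝ᵥ f} = {y | n * τ < ∑ i, g (y i)} := by
    ext y
    simp only [Set.mem_ofPred_eq, empRow_dotProduct, hg, Finset.sum_sub_distrib, Finset.sum_const,
      Finset.card_univ, Fintype.card_fin, nsmul_eq_mul]
    rw [← mul_lt_mul_iff_right₀ hn', mul_sub, ← mul_assoc, mul_one_div_cancel hn'.ne', one_mul]
  rw [hset]
  refine (mass_lt_le_sum_exp (fun y => Finset.prod_nonneg fun i _ => hk0 _) _ _ hl0).trans ?_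
  rw [sum_prod_mul_exp_sum]
  have hmgf := sum_mul_exp_le hk0 hk1 hl0 hlb hf hg0
  have hpos : 0 ≤ ∑ s, k s * Real.exp (l * g s) :=
    Finset.sum_nonneg fun s _ => mul_nonneg (hk0 s) (Real.exp_pos _).le
  calc _ ≤ Real.exp (-(l * (n * τ))) * Real.exp (l ^ 2 * vecVar k f) ^ n := by
        gcongr
        exact hmgf
    _ = Real.exp (n * (l ^ 2 * vecVar k f - l * τ)) := by
        rw [← Real.exp_nat_mul, ← Real.exp_add]; congr 1; ring
    _ ≤ _ := by
        refine Real.exp_le_exp.2 ?_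
        have := mul_le_mul_of_nonneg_left hl hn'.le
        linarith

/-- **Bernstein's inequality** for the empirical distribution of `n` independent draws. -/
lemma mass_bernstein {n : ℕ} (hn : 0 < n) {k : S → ℝ} (hk0 : ∀ s, 0 ≤ k s)
    (hk1 : ∑ s, k s = 1) {f : S → ℝ} {b ε : ℝ} (hb : 0 < b) (hε : 0 ≤ ε)
    (hf : ∀ s, |f s - k ⬝ᵥ f| ≤ b) :
    mass (fun y : Fin n → S => ∏ i, k (y i))
      {y | 2 * √(vecVar k f * ε) + b * ε < |empRow y ⬝ᵥ f - k ⬝ᵥ f|} ≤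
        2 * Real.exp (-(n * ε)) := by
  have hw : ∀ y : Fin n → S, 0 ≤ ∏ i, k (y i) := fun y => Finset.prod_nonneg fun i _ => hk0 _
  have h1 := mass_bernstein_upper hn hk0 hk1 hb hε hf
  have h2 := mass_bernstein_upper hn hk0 hk1 (f := -f) hb hε (fun s => by
    rw [dotProduct_neg, Pi.neg_apply, ← abs_neg]; convert hf s using 2; ring)
  rw [vecVar_neg] at h2
  refine (mass_mono hw ?_).trans ((mass_union_le hw _ _).trans ((add_le_add h1 h2).trans_eq ?_))
  · intro y hy
    rw [Set.mem_ofPred_eq] at hy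
    rcases lt_abs.1 hy with h | h
    · exact Or.inl h
    · refine Or.inr ?_
      simp only [Set.mem_ofPred_eq, dotProduct_neg]
      linarith
  · ring

/-- With overwhelming probability an empirical row is close to the row it is sampled from. -/
lemma mass_not_rowClose_le {n : ℕ} (hn : 0 < n) {k : S → ℝ} (hk0 : ∀ s, 0 ≤ k s)
    (hk1 : ∑ s, k s = 1) {u : S → ℝ} {B ε : ℝ} (hB : 0 < B) (hε : 0 ≤ ε)
    (hu : ∀ s, |u s| ≤ B) (hu2 : ∀ s s', u s - u s' ≤ B) :
    mass (fun y : Fin n → S => ∏ i, k (y i)) {y | ¬ RowClose k (empRow y) u B ε} ≤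
        4 * Real.exp (-(n * ε)) := by
  have hw : ∀ y : Fin n → S, 0 ≤ ∏ i, k (y i) := fun y => Finset.prod_nonneg fun i _ => hk0 _
  have hdev : ∀ (f : S → ℝ) (b : ℝ), (∀ s s', f s - f s' ≤ b) → ∀ s, |f s - k ⬝ᵥ f| ≤ b := by
    intro f b h s
    have e1 : f s - k ⬝ᵥ f = k ⬝ᵥ fun s' => f s - f s' := by
      have : (fun s' => f s - f s') = (fun _ => f s) - f := rfl
      rw [this, dotProduct_sub, dotProduct_const hk1]
    rw [e1]
    exact abs_dotProduct_le_of_abs_le hk0 hk1 fun s' =>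
      abs_le.2 ⟨by linarith [h s' s], h s s'⟩
  have h1 := mass_bernstein hn hk0 hk1 hB hε (hdev u B hu2)
  have hsq : ∀ s s', u s ^ 2 - u s' ^ 2 ≤ B ^ 2 := fun s s' => by
    have : u s ^ 2 ≤ B ^ 2 := sq_le_sq' (by linarith [(abs_le.1 (hu s)).1]) (abs_le.1 (hu s)).2
    nlinarith [sq_nonneg (u s')]
  have h2 := mass_bernstein hn hk0 hk1 (f := fun s => u s ^ 2) (b := B ^ 2) (by positivity) hε
    (hdev _ _ hsq)
  refine (mass_mono hw ?_).trans ((mass_union_le hw _ _).trans ((add_le_add h1 h2).trans_eq ?_))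
  · intro y hy
    simp only [Set.mem_ofPred_eq, RowClose, not_and_or, not_le] at hy
    rcases hy with h | h
    · exact Or.inl h
    · refine Or.inr (lt_of_le_of_lt ?_ h)
      -- Reduces Bernstein's bound for u² to the variance of u itself, as `RowClose` requires.
      have e : √(vecVar k (fun s => u s ^ 2) * ε) ≤ 2 * B * √(vecVar k u * ε) := by
        rw [← Real.sqrt_sq (show 0 ≤ 2 * B by positivity), ← Real.sqrt_mul (sq_nonneg _),
          ← mul_assoc]
        exact Real.sqrt_le_sqrt (mul_le_mul_of_nonneg_right (vecVar_sq_le hk0 hk1 hu) hε)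
      linarith
  · ring

end Bernstein

/-! ### Conditioning on all coordinates but one -/

section Resampling

variable {ι α : Type*} [Fintype ι] [DecidableEq ι] [Fintype α]

/-- Bounding a set under a product weight by its sections in one coordinate. -/
lemma mass_prod_le_of_update {w : ι → α → ℝ} (hw0 : ∀ i a, 0 ≤ w i a) (hw1 : ∀ i, ∑ a, w i a = 1)
    (i : ι) {F : Set (ι → α)} {c : ℝ}
    (h : ∀ x, mass (w i) {a | Function.update x i a ∈ F} ≤ c) :
    mass (fun x : ι → α => ∏ j, w j (x j)) F ≤ c := by
  classical
  have hsplit : ∀ g : (ι → α) → ℝ, ∑ x : ι → α, g x =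
      ∑ x' : {j // j ≠ i} → α, ∑ a, g ((Equiv.funSplitAt i α).symm (a, x')) := by
    intro g
    rw [← (Equiv.funSplitAt i α).symm.sum_comp, Fintype.sum_prod_type, Finset.sum_comm]
  have hprod : ∀ (a : α) (x' : {j // j ≠ i} → α),
      ∏ j, w j ((Equiv.funSplitAt i α).symm (a, x') j) = w i a * ∏ j, w j.1 (x' j) := by
    intro a x'
    rw [Fintype.prod_eq_mul_prod_subtype_ne _ i]
    congr 1
    · simp [Equiv.funSplitAt, Equiv.piSplitAt]
    · exact Finset.prod_congr rfl fun j _ => by simp [Equiv.funSplitAt, Equiv.piSplitAt, j.2]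
  have hone : ∑ x' : {j // j ≠ i} → α, ∏ j, w j.1 (x' j) = 1 := by
    have := Finset.prod_univ_sum (fun _ : {j // j ≠ i} => (Finset.univ : Finset α))
      (fun j a => w j.1 a)
    rw [Fintype.piFinset_univ] at this
    rw [← this]
    exact Finset.prod_eq_one fun j _ => hw1 _
  have hnn : ∀ x' : {j // j ≠ i} → α, 0 ≤ ∏ j, w j.1 (x' j) := fun x' =>
    Finset.prod_nonneg fun j _ => hw0 _ _
  rw [mass, hsplit, ← one_mul c, ← hone, Finset.sum_mul]
  refine Finset.sum_le_sum fun x' _ => ?_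
  by_cases hα : Nonempty α
  · obtain ⟨a₀⟩ := hα
    have hx := mul_le_mul_of_nonneg_left (h ((Equiv.funSplitAt i α).symm (a₀, x'))) (hnn x')
    refine le_trans (le_of_eq ?_) hx
    rw [mass, Finset.mul_sum]
    refine Finset.sum_congr rfl fun a _ => ?_
    have hupd : Function.update ((Equiv.funSplitAt i α).symm (a₀, x')) i a =
        (Equiv.funSplitAt i α).symm (a, x') := by
      funext j
      by_cases hj : j = i
      · subst hj; simp [Equiv.funSplitAt, Equiv.piSplitAt]
      · simp [Equiv.funSplitAt, Equiv.piSplitAt, hj]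
    by_cases hF : (Equiv.funSplitAt i α).symm (a, x') ∈ F
    · rw [Set.indicator_of_mem hF, Set.indicator_of_mem (by simpa [hupd] using hF), hprod, mul_comm]
    · rw [Set.indicator_of_notMem hF, Set.indicator_of_notMem (by simpa [hupd] using hF), mul_zero]
  · have := hw1 i
    rw [not_nonempty_iff] at hα
    simp at this

end Resampling

/-! ### From product weights to the probability space -/

section Sampling

variable {S A Ω : Type*} [Fintype S] [Fintype A] {p : S × A → S → ℝ} {ζ : ℝ} {n : ℕ}

/-- The probability of the table of samples `x`. -/
noncomputable def tableWeight (p : S × A → S → ℝ) (x : S × A → Fin n → S) : ℝ :=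
  ∏ z, ∏ i, p z (x z i)

lemma tableWeight_nonneg (hp : IsTransitionKernel p) (x : S × A → Fin n → S) :
    0 ≤ tableWeight p x :=
  Finset.prod_nonneg fun z _ => Finset.prod_nonneg fun _ _ => (hp z).1 _

variable [MeasurableSpace S] [DiscreteMeasurableSpace S] [MeasurableSpace Ω] {P : Measure Ω}
  {Z : S × A → Ω → ℝ} {X : (S × A) × Fin n → Ω → S}

lemma measure_samples_eq (hp : IsTransitionKernel p) (h : IsSampling P p ζ n Z X)
    (x : S × A → Fin n → S) {D : Set (S × A → ℝ)} (hD : MeasurableSet D) :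
    P ({ω | (fun z => Z z ω) ∈ D} ∩ {ω | (fun z i => X (z, i) ω) = x}) =
      P {ω | (fun z => Z z ω) ∈ D} * ENNReal.ofReal (tableWeight p x) := by
  have e1 : {ω | (fun z i => X (z, i) ω) = x} =
      (fun ω k => X k ω) ⁻¹' {fun k => x k.1 k.2} := by
    ext ω
    simp only [Set.mem_ofPred_eq, Set.mem_preimage, Set.mem_singleton_iff, funext_iff, Prod.forall]
  have e2 : (fun ω k => X k ω) ⁻¹' {fun k => x k.1 k.2} =
      ⋂ k ∈ (Finset.univ : Finset ((S × A) × Fin n)), X k ⁻¹' {x k.1 k.2} := by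
    ext ω
    simp [funext_iff]
  have e3 : P ((fun ω k => X k ω) ⁻¹' {fun k => x k.1 k.2}) =
      ENNReal.ofReal (tableWeight p x) := by
    rw [e2, h.indep_X.measure_inter_preimage_eq_mul Finset.univ
      (fun k _ => MeasurableSet.singleton _), tableWeight, ← Finset.univ_product_univ,
      Finset.prod_product, ENNReal.ofReal_prod_of_nonneg
        (fun z _ => Finset.prod_nonneg fun _ _ => (hp z).1 _)]
    refine Finset.prod_congr rfl fun z _ => ?_
    rw [ENNReal.ofReal_prod_of_nonneg fun _ _ => (hp z).1 _]
    exact Finset.prod_congr rfl fun i _ => h.law_X z i _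
  rw [e1, ← e3]
  exact h.indep_Z_X.measure_inter_preimage_eq_mul D _ hD (MeasurableSet.singleton _)

/-- The table takes finitely many values, so measurability of each section in the perturbation
suffices. -/
lemma measurableSet_samples (h : IsSampling P p ζ n Z X)
    {D : (S × A → Fin n → S) → Set (S × A → ℝ)} (hD : ∀ x, MeasurableSet (D x)) :
    MeasurableSet {ω | (fun z => Z z ω) ∈ D (fun z i => X (z, i) ω)} := by
  have e : {ω | (fun z => Z z ω) ∈ D (fun z i => X (z, i) ω)} =
      ⋃ x, {ω | (fun z => Z z ω) ∈ D x} ∩ {ω | (fun z i => X (z, i) ω) = x} := by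
    ext ω; simp
  rw [e]
  refine MeasurableSet.iUnion fun x => MeasurableSet.inter ?_ ?_
  · exact measurable_pi_lambda _ h.measurable_Z (hD x)
  · have : Measurable fun ω => (fun z i => X (z, i) ω : S × A → Fin n → S) :=
      measurable_pi_lambda _ fun z => measurable_pi_lambda _ fun i => h.measurable_X _
    exact this (MeasurableSet.singleton x)

/-- An event that has small mass under the sampling weights for every value of the reward
perturbation has small probability. -/
lemma measure_samples_le [DecidableEq S] [DecidableEq A] [IsProbabilityMeasure P] (hp : IsTransitionKernel p)
    (h : IsSampling P p ζ n Z X)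
    {D : (S × A → Fin n → S) → Set (S × A → ℝ)} (hD : ∀ x, MeasurableSet (D x)) {c : ℝ}
    (hc : ∀ g, mass (tableWeight p) {x | g ∈ D x} ≤ c) :
    P {ω | (fun z => Z z ω) ∈ D (fun z i => X (z, i) ω)} ≤ ENNReal.ofReal c := by
  have hZ : Measurable fun ω z => Z z ω := measurable_pi_lambda _ h.measurable_Z
  have : IsProbabilityMeasure (P.map fun ω z => Z z ω) :=
    Measure.isProbabilityMeasure_map hZ.aemeasurable
  calc P {ω | (fun z => Z z ω) ∈ D (fun z i => X (z, i) ω)}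
      ≤ P (⋃ x, {ω | (fun z => Z z ω) ∈ D x} ∩ {ω | (fun z i => X (z, i) ω) = x}) := by
        refine measure_mono fun ω hω => ?_
        exact Set.mem_iUnion.2 ⟨_, hω, rfl⟩
    _ ≤ ∑ x, P ({ω | (fun z => Z z ω) ∈ D x} ∩ {ω | (fun z i => X (z, i) ω) = x}) :=
        measure_iUnion_fintype_le _ _
    _ = ∑ x, ∫⁻ g, (D x).indicator (fun _ => ENNReal.ofReal (tableWeight p x)) g
          ∂(P.map fun ω z => Z z ω) := by
        refine Finset.sum_congr rfl fun x _ => ?_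
        rw [measure_samples_eq hp h x (hD x), lintegral_indicator_const (hD x),
          Measure.map_apply hZ (hD x), mul_comm]
        rfl
    _ = ∫⁻ g, ∑ x, (D x).indicator (fun _ => ENNReal.ofReal (tableWeight p x)) g
          ∂(P.map fun ω z => Z z ω) :=
        (lintegral_finsetSum _ fun x _ => measurable_const.indicator (hD x)).symm
    _ ≤ ∫⁻ _, ENNReal.ofReal c ∂(P.map fun ω z => Z z ω) := by
        refine lintegral_mono fun g => ?_
        refine le_trans (le_of_eq ?_) (ENNReal.ofReal_le_ofReal (hc g))
        rw [mass, ENNReal.ofReal_sum_of_nonneg fun x _ =>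
          Set.indicator_nonneg (fun x _ => tableWeight_nonneg hp x) x]
        refine Finset.sum_congr rfl fun x _ => ?_
        by_cases hx : g ∈ D x
        · rw [Set.indicator_of_mem hx, Set.indicator_of_mem (s := {x | g ∈ D x}) hx]
        · rw [Set.indicator_of_notMem hx, Set.indicator_of_notMem (s := {x | g ∈ D x}) hx,
            ENNReal.ofReal_zero]
    _ = ENNReal.ofReal c := by simp

end Sampling

/-! ### Measurability in the reward perturbation -/

section Measurability

variable {S A T : Type*} [Fintype S] [MeasurableSpace T] {γ : ℝ}
  {k : S × A → S → ℝ} {R : T → S × A → ℝ}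

lemma measurable_lookahead (hR : ∀ z, Measurable fun g => R g z) {v : T → S → ℝ}
    (hv : ∀ s, Measurable fun g => v g s) (z : S × A) :
    Measurable fun g => lookahead γ k (R g) (v g) z := by
  simp only [lookahead]
  fun_prop

lemma measurableSet_rowClose (x y : S → ℝ) {u : T → S → ℝ} (hu : ∀ s, Measurable fun g => u g s)
    (B ε : ℝ) : MeasurableSet {g | RowClose x y (u g) B ε} := by
  have h1 : ∀ x : S → ℝ, Measurable fun g => x ⬝ᵥ u g := by
    intro x; simp only [dotProduct]; fun_prop
  have h2 : ∀ x : S → ℝ, Measurable fun g => x ⬝ᵥ fun s => u g s ^ 2 := by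
    intro x; simp only [dotProduct]; fun_prop
  have h3 : Measurable fun g => √(vecVar x (u g) * ε) := by
    have : Measurable fun g => vecVar x (u g) := by
      have := h1 x
      simp only [vecVar]
      rw [show (fun g => x ⬝ᵥ fun s => (u g s - x ⬝ᵥ u g) ^ 2) =
        fun g => ∑ s, x s * (u g s - x ⬝ᵥ u g) ^ 2 from rfl]
      fun_prop
    fun_prop
  have h1x := h1 x
  have h1y := h1 y
  have h2x := h2 x
  have h2y := h2 y
  simp only [RowClose, Set.ofPred_and]
  refine (measurableSet_le ?_ ?_).inter (measurableSet_le ?_ ?_) <;> fun_prop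

variable [DecidableEq S]

lemma measurable_value (hR : ∀ z, Measurable fun g => R g z) (π : S → A) (s : S) :
    Measurable fun g => value γ k (R g) π s := by
  simp only [value, Matrix.mulVec, dotProduct]
  fun_prop

lemma measurableSet_hasGap [Finite A] (hR : ∀ z, Measurable fun g => R g z) (π : S → A) (η : ℝ) :
    MeasurableSet {g | HasGap γ k (R g) π η} := by
  have hv := measurable_value (γ := γ) (k := k) hR π
  have hq := fun z => measurable_lookahead (γ := γ) (k := k) hR hv z
  simp only [HasGap, actionValue, Set.ofPred_forall]
  exact .iInter fun s => .iInter fun b => .iInter fun _ =>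
    measurableSet_le measurable_const ((hv s).sub (hq _))

lemma measurableSet_hasStrictGap [Finite A] (hR : ∀ z, Measurable fun g => R g z) (π : S → A) :
    MeasurableSet {g | HasStrictGap γ k (R g) π} := by
  have hv := measurable_value (γ := γ) (k := k) hR π
  have hq := fun z => measurable_lookahead (γ := γ) (k := k) hR hv z
  simp only [HasStrictGap, actionValue, Set.ofPred_forall]
  exact .iInter fun s => .iInter fun b => .iInter fun _ =>
    measurableSet_lt measurable_const ((hv s).sub (hq _))

lemma measurableSet_isOptimalPolicy [Finite A] (hR : ∀ z, Measurable fun g => R g z) (π : S → A) :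
    MeasurableSet {g | IsOptimalPolicy γ k (R g) π} := by
  simp only [IsOptimalPolicy, Set.ofPred_forall]
  exact .iInter fun π' => .iInter fun s =>
    measurableSet_le (measurable_value hR π' s) (measurable_value hR π s)

end Measurability

/-! ### Decoupling the greedy policy from a single row -/

section Decoupling

variable {S A : Type*} [DecidableEq S] {γ : ℝ} {p : S × A → S → ℝ} {R : S × A → ℝ} {n : ℕ}

/-- The empirical kernel of a table of samples. -/
noncomputable def empTable (x : S × A → Fin n → S) : S × A → S → ℝ := fun z => empRow (x z)

/-- The independence at the heart of the decoupling: the cut process at z is unaffected by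
resampling the row z. -/
lemma cutKernel_empTable_update [DecidableEq A] (x : S × A → Fin n → S) (z : S × A) (y : Fin n → S) :
    cutKernel (empTable (Function.update x z y)) z = cutKernel (empTable x) z := by
  funext z'
  by_cases h : z' = z
  · subst h; simp [cutKernel]
  · simp [cutKernel, empTable, h]

variable [Fintype S]

lemma isTransitionKernel_empTable (hn : 0 < n) (x : S × A → Fin n → S) :
    IsTransitionKernel (empTable x) :=
  fun z => ⟨empRow_nonneg (x z), sum_empRow hn (x z)⟩

/-- The value of `π`, shifted to vanish at `s₀`. -/
noncomputable def centredValue (γ : ℝ) (p : S × A → S → ℝ) (R : S × A → ℝ) (s₀ : S) (π : S → A) :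
    S → ℝ := fun s => value γ p R π s - value γ p R π s₀

/-- Some row of the table is not close to its mean, either for the policy with a strict gap in one
of the cut processes with grid rewards, or for an optimal policy. -/
def BadTable (γ : ℝ) (p : S × A → S → ℝ) (R : S × A → ℝ) (s₀ : S) (B ε h : ℝ) (N : ℕ)
    (x : S × A → Fin n → S) : Prop :=
  (∃ z, ∃ j ∈ Finset.range N, ∃ π,
    HasStrictGap γ (cutKernel (empTable x) z) (cutReward R z (j * h)) π ∧
      ¬ RowClose (p z) (empTable x z) (centredValue γ p R s₀ π) B ε) ∨
  ∃ z, ∃ π, IsOptimalPolicy γ p R π ∧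
      ¬ RowClose (p z) (empTable x z) (centredValue γ p R s₀ π) B ε

/-- A policy with an optimality gap for the kernel of a good table has close rows. -/
lemma rowClose_of_hasGap (hn : 0 < n) (hγ0 : 0 ≤ γ) (hγ1 : γ < 1)
    (hR : ∀ z, R z ∈ Set.Icc (0 : ℝ) 2) {x : S × A → Fin n → S} {π : S → A} {η : ℝ} (hη : 0 < η)
    (hgap : HasGap γ (empTable x) R π η) {s₀ : S} {B ε : ℝ} {N : ℕ}
    (hN : 4 / (η * (1 - γ)) < N) (hx : ¬ BadTable γ p R s₀ B ε (η / 2) N x) (z : S × A) :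
    RowClose (p z) (empTable x z) (centredValue γ p R s₀ π) B ε := by
  have hk := (isTransitionKernel_empTable hn x).isSubKernel
  have h1γ : 0 < 1 - γ := by linarith
  set w := actionValue γ (empTable x) R π z with hw
  have hw0 : 0 ≤ w := by
    have : 0 ≤ empTable x z ⬝ᵥ value γ (empTable x) R π :=
      Finset.sum_nonneg fun s _ => mul_nonneg ((hk z).1 s)
        (value_nonneg hk hγ0 hγ1 (fun z => (hR z).1) π s)
    have := mul_nonneg hγ0 this
    rw [hw, actionValue, lookahead_eq]
    linarith [(hR z).1]
  have hw1 : w ≤ 2 / (1 - γ) := by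
    have := mul_le_mul_of_nonneg_left (dotProduct_le_of_le (hk z).1 (hk z).2
      (show 0 ≤ 2 / (1 - γ) by positivity)
      (value_le_of_reward_le hk hγ0 hγ1 zero_le_two (fun z => (hR z).2) π)) hγ0
    have e : 2 + γ * (2 / (1 - γ)) = 2 / (1 - γ) := by field_simp; ring
    rw [hw, actionValue, lookahead_eq]
    linarith [(hR z).2]
  -- The grid point just below w is at distance less than η/2, so twice the distance is less than η.
  -- It lies in the range because w ≤ 2/(1 - γ).
  have hj1 := Nat.floor_le (show 0 ≤ w / (η / 2) by positivity)
  have hj2 := Nat.lt_floor_add_one (w / (η / 2))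
  set j := ⌊w / (η / 2)⌋₊ with hj
  have hjN : j ∈ Finset.range N := by
    rw [Finset.mem_range, ← Nat.cast_lt (α := ℝ)]
    refine lt_of_le_of_lt (hj1.trans ?_) hN
    calc w / (η / 2) ≤ 2 / (1 - γ) / (η / 2) := by gcongr
      _ = 4 / (η * (1 - γ)) := by field_simp; ring
  rw [le_div_iff₀ (by positivity)] at hj1
  rw [div_lt_iff₀ (by positivity)] at hj2
  have hstrict := hgap.hasStrictGap_cut hk hγ0 hγ1 z (w := j * (η / 2)) (by
    rw [← hw, abs_of_nonpos (by linarith)]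
    linarith)
  by_contra hc
  exact hx (Or.inl ⟨z, j, hjN, π, hstrict, hc⟩)

variable [Fintype A] [DecidableEq A]

/-- If for each table the property `Q`, which does not involve the row `z`, is met by policies of
at most one value, then the row `z` is close to its mean for these policies. -/
lemma mass_exists_not_rowClose_le (hn : 0 < n) (hp : IsTransitionKernel p) {B ε : ℝ} (hB : 0 < B)
    (hε : 0 ≤ ε) (hspan : ∀ π s s', value γ p R π s - value γ p R π s' ≤ B) (s₀ : S) (z : S × A)
    (Q : (S × A → Fin n → S) → (S → A) → Prop)
    (hQ : ∀ x y π, Q (Function.update x z y) π ↔ Q x π)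
    (huniq : ∀ x π π', Q x π → Q x π' → value γ p R π = value γ p R π') :
    mass (tableWeight p) {x | ∃ π, Q x π ∧
      ¬ RowClose (p z) (empTable x z) (centredValue γ p R s₀ π) B ε} ≤ 4 * Real.exp (-(n * ε)) := by
  have hw0 : ∀ (z : S × A) (y : Fin n → S), 0 ≤ ∏ i, p z (y i) :=
    fun z y => Finset.prod_nonneg fun _ _ => (hp z).1 _
  have hw1 : ∀ z : S × A, ∑ y : Fin n → S, ∏ i, p z (y i) = 1 := by
    intro z
    have := Finset.prod_univ_sum (fun _ : Fin n => (Finset.univ : Finset S)) (fun _ s => p z s)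
    rw [Fintype.piFinset_univ] at this
    rw [← this]
    exact Finset.prod_eq_one fun _ _ => (hp z).2
  refine mass_prod_le_of_update (w := fun z (y : Fin n → S) => ∏ i, p z (y i)) hw0 hw1 z
    fun x => ?_
  -- Resampling the row z does not change Q. Either no policy qualifies for any resample, or all
  -- that do share one fixed centred value, to which Bernstein's bound applies.
  by_cases hx : ∃ π, Q x π
  · obtain ⟨π, hπ⟩ := hx
    refine (mass_mono (hw0 z) ?_).trans (mass_not_rowClose_le hn (hp z).1 (hp z).2 (n := n)
      (u := centredValue γ p R s₀ π) hB hε (fun s => ?_) fun s s' => ?_)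
    · rintro y ⟨π', hπ', h⟩
      have hc : centredValue γ p R s₀ π' = centredValue γ p R s₀ π := by
        unfold centredValue
        rw [huniq x π' π ((hQ x y π').1 hπ') hπ]
      rw [hc] at h
      simpa [empTable] using h
    · exact abs_le.2 ⟨by have := hspan π s₀ s; simp only [centredValue]; linarith, hspan π s s₀⟩
    · have := hspan π s s'
      simp only [centredValue]; linarith
  · have : {y | Function.update x z y ∈ {x | ∃ π, Q x π ∧
        ¬ RowClose (p z) (empTable x z) (centredValue γ p R s₀ π) B ε}} = ∅ := by
      refine Set.eq_empty_of_forall_notMem ?_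
      rintro y ⟨π, hπ, -⟩
      exact hx ⟨π, (hQ x y π).1 hπ⟩
    rw [this, mass_empty]
    positivity

/-- Union bound: for each of the |S||A| pairs there are N grid rewards and one extra event for the
optimal policies, whose values agree. -/
lemma mass_badTable_le (hn : 0 < n) (hp : IsTransitionKernel p) (hγ0 : 0 ≤ γ) (hγ1 : γ < 1)
    {B ε : ℝ} (hB : 0 < B) (hε : 0 ≤ ε)
    (hspan : ∀ π s s', value γ p R π s - value γ p R π s' ≤ B) (s₀ : S) (h : ℝ) (N : ℕ) :
    mass (tableWeight p) {x : S × A → Fin n → S | BadTable γ p R s₀ B ε h N x} ≤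
      (Fintype.card S * Fintype.card A) * (N + 1) * (4 * Real.exp (-(n * ε))) := by
  set c := 4 * Real.exp (-(n * ε)) with hc
  have hw := tableWeight_nonneg (n := n) hp
  have hcut : ∀ z (j : ℕ), mass (tableWeight p) {x : S × A → Fin n → S | ∃ π,
      HasStrictGap γ (cutKernel (empTable x) z) (cutReward R z (j * h)) π ∧
      ¬ RowClose (p z) (empTable x z) (centredValue γ p R s₀ π) B ε} ≤ c := by
    intro z j
    refine mass_exists_not_rowClose_le hn hp hB hε hspan s₀ z _ (fun x y π => ?_)
      fun x π π' h1 h2 => ?_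
    · rw [cutKernel_empTable_update]
    · rw [h2.unique (isSubKernel_cutKernel (isTransitionKernel_empTable hn x).isSubKernel z)
        hγ0 hγ1 h1]
  have hopt : ∀ z, mass (tableWeight p) {x : S × A → Fin n → S | ∃ π, IsOptimalPolicy γ p R π ∧
      ¬ RowClose (p z) (empTable x z) (centredValue γ p R s₀ π) B ε} ≤ c := by
    intro z
    refine mass_exists_not_rowClose_le hn hp hB hε hspan s₀ z (fun _ π => IsOptimalPolicy γ p R π)
      (fun x y π => Iff.rfl) fun x π π' h1 h2 => ?_
    funext s
    exact le_antisymm (h2 π s) (h1 π' s)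
  have hsub : {x : S × A → Fin n → S | BadTable γ p R s₀ B ε h N x} ⊆
      (⋃ z ∈ (Finset.univ : Finset (S × A)), ⋃ j ∈ Finset.range N, {x | ∃ π,
        HasStrictGap γ (cutKernel (empTable x) z) (cutReward R z (j * h)) π ∧
        ¬ RowClose (p z) (empTable x z) (centredValue γ p R s₀ π) B ε}) ∪
      ⋃ z ∈ (Finset.univ : Finset (S × A)), {x | ∃ π, IsOptimalPolicy γ p R π ∧
        ¬ RowClose (p z) (empTable x z) (centredValue γ p R s₀ π) B ε} := by
    rintro x (⟨z, j, hj, hx⟩ | ⟨z, hx⟩)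
    · exact Or.inl (Set.mem_biUnion (Finset.mem_univ z) (Set.mem_biUnion hj hx))
    · exact Or.inr (Set.mem_biUnion (Finset.mem_univ z) hx)
  refine (mass_mono hw hsub).trans ((mass_union_le hw _ _).trans ?_)
  have e1 := (mass_biUnion_le hw (Finset.univ : Finset (S × A)) fun z =>
    ⋃ j ∈ Finset.range N, {x : S × A → Fin n → S | ∃ π,
        HasStrictGap γ (cutKernel (empTable x) z) (cutReward R z (j * h)) π ∧
        ¬ RowClose (p z) (empTable x z) (centredValue γ p R s₀ π) B ε}).trans
    (Finset.sum_le_sum fun z _ => (mass_biUnion_le hw _ _).trans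
      (Finset.sum_le_sum fun j _ => hcut z j))
  have e2 := (mass_biUnion_le hw (Finset.univ : Finset (S × A)) fun z =>
    {x : S × A → Fin n → S | ∃ π, IsOptimalPolicy γ p R π ∧
        ¬ RowClose (p z) (empTable x z) (centredValue γ p R s₀ π) B ε}).trans
    (Finset.sum_le_sum fun z _ => hopt z)
  simp only [Finset.sum_const, Finset.card_univ, Fintype.card_prod, Finset.card_range,
    nsmul_eq_mul, Nat.cast_mul] at e1 e2
  linarith

lemma measurableSet_badTable {T : Type*} [MeasurableSpace T] {R : T → S × A → ℝ}
    (hR : ∀ z, Measurable fun g => R g z) (s₀ : S) (B ε h : ℝ) (N : ℕ) (x : S × A → Fin n → S) :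
    MeasurableSet {g | BadTable γ p (R g) s₀ B ε h N x} := by
  have hrow : ∀ z π, MeasurableSet
      {g | ¬ RowClose (p z) (empTable x z) (centredValue γ p (R g) s₀ π) B ε} := by
    intro z π
    refine (measurableSet_rowClose (p z) (empTable x z) (fun s => ?_) B ε).compl
    exact (measurable_value hR π s).sub (measurable_value hR π s₀)
  have hcutR : ∀ z w z', Measurable fun g => cutReward (R g) z w z' := by
    intro z w z'
    by_cases hz : z' = z
    · subst hz; simp [cutReward]
    · simpa [cutReward, hz] using hR z'
  simp only [BadTable, Set.ofPred_or, Set.ofPred_exists, Set.ofPred_and]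
  refine .union (.iUnion fun z => .iUnion fun j => .inter (.const _) (.iUnion fun π => ?_))
    (.iUnion fun z => .iUnion fun π => ?_)
  · exact (measurableSet_hasStrictGap (hcutR z _) π).inter (hrow z π)
  · exact (measurableSet_isOptimalPolicy hR π).inter (hrow z π)

end Decoupling

/-! ### Numerical constants in the union bound -/

section Constants

variable {S A : Type*} [Fintype S] [Fintype A] [Nonempty S] [Nonempty A] {γ δ η : ℝ}

lemma beta_bounds (hγ : γ ∈ Set.Ico (1 / 2 : ℝ) 1) (hδ : δ ∈ Set.Ioo (0 : ℝ) 1)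
    (hη : η ∈ Set.Ioc (0 : ℝ) 1) :
    0 < beta S A γ δ η ∧ (Fintype.card S * Fintype.card A) * Real.exp (-(beta S A γ δ η / 2)) ≤
      (1 - γ) ^ 2 * η * δ / 24 := by
  have h1γ : 0 < 1 - γ := by linarith [hγ.2]
  have hη0 := hη.1
  have hδ0 := hδ.1
  have hS : (1 : ℝ) ≤ Fintype.card S := by exact_mod_cast Fintype.card_pos
  have hA : (1 : ℝ) ≤ Fintype.card A := by exact_mod_cast Fintype.card_pos
  -- From γ ≥ 1/2 one has (1 - γ)⁻¹ ≥ 2; only this lower bound on the logarithmic factor is needed.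
  have hlog : 1 ≤ Real.logb 2 ((1 - γ)⁻¹) := by
    rw [Real.le_logb_iff_rpow_le (by norm_num) (by positivity), Real.rpow_one,
      le_inv_comm₀ (by norm_num) h1γ]
    linarith [hγ.1]
  set D := (1 - γ) ^ 2 * η * δ with hD
  have hD0 : 0 < D := by positivity
  have hD1 : D ≤ 1 := by
    have : (1 - γ) ^ 2 ≤ 1 := pow_le_one₀ h1γ.le (by linarith [hγ.1])
    exact mul_le_one₀ (mul_le_one₀ this hη0.le hη.2) hδ0.le hδ.2.le
  set N := 24 * (Fintype.card S : ℝ) * (Fintype.card A : ℝ) * Real.logb 2 ((1 - γ)⁻¹) with hN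
  have hSA : (1 : ℝ) ≤ Fintype.card S * Fintype.card A := one_le_mul_of_one_le_of_one_le hS hA
  have hN1 : 24 * ((Fintype.card S : ℝ) * Fintype.card A) ≤ N := by
    rw [hN]; nlinarith
  have hN0 : 0 < N := by linarith
  refine ⟨?_, ?_⟩
  · refine mul_pos two_pos (Real.log_pos ?_)
    rw [lt_div_iff₀ hD0]
    linarith
  · have : beta S A γ δ η / 2 = Real.log (N / D) := by rw [beta]; ring
    rw [this, Real.exp_neg, Real.exp_log (by positivity), inv_div, mul_div_assoc', div_le_div_iff₀
      hN0 (by norm_num)]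
    nlinarith

/-- The grid size is of order 1/(η(1 - γ)), which the factor (1 - γ)²η inside β absorbs; the
remaining δ/3 is left for the gap event. -/
lemma failure_bound (hγ : γ ∈ Set.Ico (1 / 2 : ℝ) 1) (hδ : δ ∈ Set.Ioo (0 : ℝ) 1)
    (hη : η ∈ Set.Ioc (0 : ℝ) 1) :
    (Fintype.card S * Fintype.card A) * (((⌊4 / (η * (1 - γ))⌋₊ + 1 : ℕ) : ℝ) + 1) *
      (4 * Real.exp (-(beta S A γ δ η / 2))) ≤ 2 * δ / 3 := by
  have h1γ : 0 < 1 - γ := by linarith [hγ.2]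
  have hη0 := hη.1
  have hδ0 := hδ.1
  have h := (beta_bounds (S := S) (A := A) hγ hδ hη).2
  have hfl := Nat.floor_le (show 0 ≤ 4 / (η * (1 - γ)) by positivity)
  set F := (⌊4 / (η * (1 - γ))⌋₊ : ℝ) with hF
  have hF0 : 0 ≤ F := Nat.cast_nonneg _
  push_cast
  rw [← hF]
  calc _ = 4 * (F + 2) * ((Fintype.card S * Fintype.card A) *
        Real.exp (-(beta S A γ δ η / 2))) := by ring
    _ ≤ 4 * (4 / (η * (1 - γ)) + 2) * ((1 - γ) ^ 2 * η * δ / 24) := by gcongr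
    _ = δ * ((1 - γ) * (4 + 2 * (η * (1 - γ))) / 6) := by field_simp; ring
    _ ≤ δ * (2 / 3) := by
        have h2 : 1 - γ ≤ 1 / 2 := by linarith [hγ.1]
        have h3 : η * (1 - γ) ≤ 1 := mul_le_one₀ hη.2 h1γ.le (by linarith)
        have h4 : (1 - γ) * (4 + 2 * (η * (1 - γ))) / 6 ≤ 2 / 3 := by nlinarith
        exact mul_le_mul_of_nonneg_left h4 hδ0.le
    _ = _ := by ring

end Constants

end PMBP

/-! ### The high-probability bound -/

open PMBP

theorem mainTheorem3
    {S A Ω : Type*} [Fintype S] [Fintype A] [DecidableEq S] [Nonempty S] [Nonempty A]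
    [MeasurableSpace S] [DiscreteMeasurableSpace S]
    [MeasurableSpace Ω] (P : Measure Ω) [IsProbabilityMeasure P]
    -- the decision process
    (r : S × A → ℝ) (hr : ∀ z, r z ∈ Set.Icc (0 : ℝ) 1)
    (p : S × A → S → ℝ) (hp : PMBP.IsTransitionKernel p) (herg : PMBP.UniformlyErgodic p)
    (γ : ℝ) (hγ : γ ∈ Set.Ico (1 / 2 : ℝ) 1)
    -- the parameters
    (ζ δ η : ℝ) (hζ : ζ ∈ Set.Ioc (0 : ℝ) 1) (hδ : δ ∈ Set.Ioo (0 : ℝ) 1)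
    (hη : η ∈ Set.Ioc (0 : ℝ) 1)
    (n : ℕ) (hn : 64 * PMBP.beta S A γ δ η * (1 - γ)⁻¹ ≤ (n : ℝ))
    -- the reward perturbations and the samples
    (Z : S × A → Ω → ℝ) (X : (S × A) × Fin n → Ω → S) (hZX : PMBP.IsSampling P p ζ n Z X)
    -- the output of the algorithm: the empirical Bellman solution and any greedy policy for it
    (vhat : Ω → S → ℝ)
    (hvhat : ∀ ω, PMBP.SolvesBellman γ (PMBP.empiricalKernel X ω) (PMBP.perturbedReward r Z ω)
      (vhat ω))
    (πhat : Ω → S → A)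
    (hπhat : ∀ ω, PMBP.IsGreedy γ (PMBP.empiricalKernel X ω) (PMBP.perturbedReward r Z ω)
      (vhat ω) (πhat ω))
    -- any optimal policy of the reward-perturbed process with the true kernel
    (π₀ : Ω → S → A)
    (hπ₀ : ∀ ω, PMBP.IsOptimalPolicy γ p (PMBP.perturbedReward r Z ω) (π₀ ω))
    -- the optimality-gap event has probability at least `1 - δ / 3`
    (hgap : ENNReal.ofReal (1 - δ / 3) ≤
      P {ω | PMBP.HasGap γ (PMBP.empiricalKernel X ω) (PMBP.perturbedReward r Z ω) (πhat ω) η}) :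
    ∃ E : Set Ω, MeasurableSet E ∧ ENNReal.ofReal (1 - δ) ≤ P E ∧ ∀ ω ∈ E,
      ‖PMBP.value γ (PMBP.empiricalKernel X ω) (PMBP.perturbedReward r Z ω) (πhat ω) -
          PMBP.value γ p (PMBP.perturbedReward r Z ω) (πhat ω)‖ ≤
        243 * √(PMBP.beta S A γ δ η * PMBP.tMinorize p / ((1 - γ) ^ 2 * n)) ∧
      ∀ s, PMBP.value γ p (PMBP.perturbedReward r Z ω) (π₀ ω) s -
          PMBP.value γ p (PMBP.perturbedReward r Z ω) (πhat ω) s ≤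
        486 * √(PMBP.beta S A γ δ η * PMBP.tMinorize p / ((1 - γ) ^ 2 * n)) := by
  classical
  have hγ0 : 0 ≤ γ := by linarith [hγ.1]
  have h1γ : 0 < 1 - γ := by linarith [hγ.2]
  have hβ := (beta_bounds (S := S) (A := A) hγ hδ hη).1
  set β := beta S A γ δ η with hβdef
  set t := tMinorize p with htdef
  have ht : 0 < t := zero_lt_one.trans_le (one_le_tMinorize herg)
  have hn0' : (0 : ℝ) < n := lt_of_lt_of_le (by positivity) hn
  have hn0 : 0 < n := by exact_mod_cast hn0'
  set ε := β / 2 / n with hε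
  have hε0 : 0 < ε := by positivity
  have hnε : (n : ℝ) * ε = β / 2 := by rw [hε]; field_simp
  -- The bound 2t produces the rate; the trivial bound 2/(1 - γ) turns the sample size condition
  -- into Bε ≤ 1/64.
  set B := min (2 * t) (2 / (1 - γ)) with hB
  have hB0 : 0 < B := lt_min (by positivity) (by positivity)
  have hBε : B * ε ≤ 1 / 64 := by
    refine (mul_le_mul_of_nonneg_right (min_le_right _ _) hε0.le).trans ?_
    have : 2 / (1 - γ) * ε = β * (1 - γ)⁻¹ / n := by rw [hε]; field_simp
    rw [this, div_le_iff₀ hn0']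
    linarith
  set y := √(β * t / ((1 - γ) ^ 2 * n)) with hy
  have hyε : √(t * ε) / (1 - γ) ≤ y := by
    rw [hy, mul_comm ((1 - γ) ^ 2), ← div_div, Real.sqrt_div' _ (sq_nonneg _),
      Real.sqrt_sq h1γ.le]
    refine div_le_div_of_nonneg_right (Real.sqrt_le_sqrt ?_) h1γ.le
    have : β * t / n = 2 * (t * ε) := by rw [hε]; field_simp
    have : 0 < t * ε := by positivity
    linarith
  have hy0 : 0 ≤ y := Real.sqrt_nonneg _
  obtain ⟨s₀⟩ := ‹Nonempty S›
  set N := ⌊4 / (η * (1 - γ))⌋₊ + 1 with hN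
  have hNlt : 4 / (η * (1 - γ)) < N := by rw [hN]; push_cast; exact Nat.lt_floor_add_one _
  have hspan : ∀ R : S × A → ℝ, (∀ z, R z ∈ Set.Icc (0 : ℝ) 2) → ∀ π s s',
      value γ p R π s - value γ p R π s' ≤ B := by
    intro R hR π s s'
    refine le_min (value_sub_value_le_tMinorize hp herg hγ0 hγ.2 two_pos hR π s s') ?_
    have := value_le_of_reward_le hp.isSubKernel hγ0 hγ.2 zero_le_two (fun z => (hR z).2) π s
    have := value_nonneg hp.isSubKernel hγ0 hγ.2 (fun z => (hR z).1) π s'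
    linarith
  have hadd : ∀ z, Measurable fun g : S × A → ℝ => r z + g z := fun z => by fun_prop
  -- The gap is required of some policy, not of `πhat`, whose measurability is not assumed;
  -- uniqueness identifies the two afterwards.
  set G : (S × A → Fin n → S) → Set (S × A → ℝ) := fun x =>
    {g | ∃ π, HasGap γ (empTable x) (fun z => r z + g z) π η} with hG
  -- The range condition is part of the event so that the mass bound holds for every perturbation
  -- vector g; it is automatic at every outcome ω.
  set D : (S × A → Fin n → S) → Set (S × A → ℝ) := fun x =>
    {g | (∀ z, r z + g z ∈ Set.Icc (0 : ℝ) 2) ∧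
      BadTable γ p (fun z => r z + g z) s₀ B ε (η / 2) N x} with hD
  have hGm : ∀ x, MeasurableSet (G x) := by
    intro x
    simp only [hG, Set.ofPred_exists]
    exact .iUnion fun π => measurableSet_hasGap hadd π η
  have hDm : ∀ x, MeasurableSet (D x) := by
    intro x
    simp only [hD, Set.ofPred_and, Set.ofPred_forall]
    exact (MeasurableSet.iInter fun z => hadd z measurableSet_Icc).inter
      (measurableSet_badTable hadd s₀ B ε (η / 2) N x)
  have hDle : P {ω | (fun z => Z z ω) ∈ D (fun z i => X (z, i) ω)} ≤
      ENNReal.ofReal (2 * δ / 3) := by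
    refine measure_samples_le hp hZX hDm fun g => ?_
    by_cases hg : ∀ z, r z + g z ∈ Set.Icc (0 : ℝ) 2
    · have h1 := mass_badTable_le hn0 hp hγ0 hγ.2 hB0 hε0.le (hspan _ hg) s₀ (η / 2) N
      rw [hnε] at h1
      refine (mass_mono (tableWeight_nonneg hp) ?_).trans
        (h1.trans (failure_bound (S := S) (A := A) hγ hδ hη))
      exact fun x hx => hx.2
    · have : {x | g ∈ D x} = ∅ := Set.eq_empty_of_forall_notMem fun x hx => hg hx.1
      rw [this, mass_empty]
      linarith [hδ.1]
  have hGge : ENNReal.ofReal (1 - δ / 3) ≤ P {ω | (fun z => Z z ω) ∈ G (fun z i => X (z, i) ω)} :=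
    hgap.trans (measure_mono fun ω hω => ⟨πhat ω, hω⟩)
  refine ⟨{ω | (fun z => Z z ω) ∈ G (fun z i => X (z, i) ω)} \
    {ω | (fun z => Z z ω) ∈ D (fun z i => X (z, i) ω)},
    (measurableSet_samples hZX hGm).diff (measurableSet_samples hZX hDm), ?_, ?_⟩
  · refine le_trans ?_ le_measure_sdiff
    refine le_trans (le_of_eq ?_) (tsub_le_tsub hGge hDle)
    rw [← ENNReal.ofReal_sub _ (by linarith [hδ.1])]
    congr 1; ring
  rintro ω ⟨⟨π, hπ⟩, hbad⟩
  set R := perturbedReward r Z ω with hR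
  set x : S × A → Fin n → S := fun z i => X (z, i) ω with hx
  have hemp : empiricalKernel X ω = empTable x := rfl
  change HasGap γ (empTable x) R π η at hπ
  have hR2 : ∀ z, R z ∈ Set.Icc (0 : ℝ) 2 := by
    intro z
    have h1 := hr z
    have h2 := hZX.mem_Z z ω
    simp only [hR, perturbedReward, Set.mem_Icc] at *
    constructor <;> linarith [hζ.2]
  have hgood : ¬ BadTable γ p R s₀ B ε (η / 2) N x := fun h => hbad ⟨hR2, h⟩
  have hk := isTransitionKernel_empTable hn0 x
  have hv := hvhat ω
  have hgr := hπhat ω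
  rw [hemp] at hv hgr ⊢
  have hopt : ∀ π' s, value γ (empTable x) R π' s ≤ value γ (empTable x) R (πhat ω) s :=
    hv.value_le_greedy hk.isSubKernel hγ0 hγ.2 hgr
  have hππ : πhat ω = π :=
    (hπ.hasStrictGap hη.1).eq_of_le hk.isSubKernel hγ0 hγ.2 (hopt π)
  rw [← hππ] at hπ
  have herr : ∀ π' : S → A, (∀ z, RowClose (p z) (empTable x z) (centredValue γ p R s₀ π') B ε) →
      ∀ s, |value γ (empTable x) R π' s - value γ p R π' s| ≤ 243 * y := by
    intro π' h s
    have h1 := abs_value_sub_le_sqrt_of_rowClose hp hk hγ hR2 π' s₀ hε0 ht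
      (u := centredValue γ p R s₀ π') (fun _ => rfl)
      (fun s => abs_le.2 ⟨by have := hspan R hR2 π' s₀ s; simp only [centredValue]; linarith,
        hspan R hR2 π' s s₀⟩) (min_le_left _ _) hBε (fun s => h _) s
    rw [mul_div_assoc] at h1
    linarith
  have h1 := herr (πhat ω) (rowClose_of_hasGap hn0 hγ0 hγ.2 hR2 hη.1 hπ hNlt hgood)
  have h2 := herr (π₀ ω) fun z => by
    by_contra hc
    exact hgood (Or.inr ⟨z, π₀ ω, hπ₀ ω, hc⟩)
  refine ⟨(pi_norm_le_iff_of_nonneg (by positivity)).2 fun s => h1 s, fun s => ?_⟩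
  have h3 := abs_le.1 (h1 s)
  have h4 := abs_le.1 (h2 s)
  have h5 := hopt (π₀ ω) s
  -- The difference splits into the error at π₀, the empirical difference between π₀ and `πhat`,
  -- which is nonpositive, and the error at `πhat`.
  linarith [h3.1, h3.2, h4.1, h4.2]
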